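/- Let $X\subset\mathbf P^N(\mathbf C)$ be a complex projective variety (possibly singular), $M=\mathcal O(1)|_X$ the corresponding very ample line bundle with a smooth positive hermitian metric $\|\cdot\|$ (the restriction to $X$ of a smooth metric on $\mathcal O(1)$ over $\mathbf P^N$ whose curvature form $c_1(M)=-\frac{i}{2\pi}\partial\bar\partial\log\|\cdot\|^2$ is positive on the nonzero Zariski tangent vectors of $X$), and $\varphi:\mathbf C\to X$ a holomorphic map. For $r>0$ put $\Delta_r=\{|z|<r\}$, $$T(r)=\int_0^r\frac{dt}{t}\int_{\Delta_t}\varphi^*c_1(M),\qquad g_r(w_0,z)=\log\left|\frac{r^2-z\overline{w_0}}{r(z-w_0)}\right| .$$ For $s\in H^0(X,M)$ let $\|s\|(z)=\|\varphi^*s\|(z)$, $\|s\|_r=\sup_{|z|\le r}\|\varphi^*s\|(z)$, and let $v_z(s)$ be the order of vanishing of $\varphi^*s$ at $z$. Then for every $r>0$ there is a set $E_r\subset\mathbf C$, depending only on $X$, $M$, $\varphi$ and $r$, which is a countable union of disks the sum of whose radii is less than $5/T(r)$ (finite, if $T(r)=0$), such that for every $s\in H^0(X,M)$ and every $w_0\in\Delta_r\setminus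 E_r$ with $s(\varphi(w_0))\neq0$ the section $\varphi^*s$ has only finitely many zeros in $\Delta_r$ and $$\sum_{|z|<r}v_z(s)\,g_r(w_0,z)+\log\|s\|(w_0)\le\log\|s\|_r+\bigl(\log T(r)+\log r+\log 2\bigr)\,T(e\,r),$$ where the last product is read as $0$ if $T(r)=0$ (that is, if $\varphi$ is constant). -/

import Mathlib

open Set Metric Filter Topology MeasureTheory
open scoped NNReal ENNReal ContDiff LinearAlgebra.Projectivization

noncomputable section

namespace EntireCurve

/-- Homogeneous coordinates on `N`-dimensional complex projective space. -/
abbrev Coord (N : ℕ) : Type := Fin (N + 1) → ℂ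

/-- The complex projective space of dimension `N`. -/
abbrev PSpace (N : ℕ) : Type := ℙ ℂ (Coord N)

/-- Closed algebraic subsets of projective space (irreducibility and smoothness are not required). -/
def IsProjectiveVariety {N : ℕ} (X : Set (PSpace N)) : Prop :=
  ∃ S : Set (MvPolynomial (Fin (N + 1)) ℂ),
    (∀ F ∈ S, ∃ d : ℕ, F.IsHomogeneous d) ∧
    X = {p | ∀ F ∈ S, MvPolynomial.eval p.rep F = 0}

/-- The affine cone over `X`, without its vertex: the homogeneous coordinate vectors of the points
of `X`. -/
def cone {N : ℕ} (X : Set (PSpace N)) : Set (Coord N) :=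
  {v | ∃ hv : v ≠ 0, Projectivization.mk ℂ v hv ∈ X}

/-- The Zariski tangent space at `v` of the affine cone over `X`. -/
def coneTangent {N : ℕ} (X : Set (PSpace N)) (v : Coord N) : Set (Coord N) :=
  {ξ | ∀ F : MvPolynomial (Fin (N + 1)) ℂ, (∀ w ∈ cone X, MvPolynomial.eval w F = 0) →
    ∑ i, MvPolynomial.eval v (MvPolynomial.pderiv i F) * ξ i = 0}

/-- The Levi form `∂²u(v + t ξ) / ∂t ∂t̄` at `t = 0` (a quarter of the Laplacian in `t`). -/
def leviForm {N : ℕ} (u : Coord N → ℝ) (v ξ : Coord N) : ℝ :=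
  (1 / 4) * Laplacian.laplacian (fun t : ℂ => u (v + t • ξ)) 0

/-- A smooth positive hermitian metric on the very ample line bundle `M = 𝒪(1)|_X`.
A hermitian metric on `𝒪(1)` is the same thing as a positive function `weight` on the nonzero
coordinate vectors with `weight (a v) = |a|² weight v`; a section `s` of `𝒪(1)`, seen as a function
on the cone that is homogeneous of degree one, has the norm `‖s‖(v) = |s v| / √(weight v)` at the
point with coordinates `v`. The metric on `𝒪(1)|_X` is the restriction of a smooth metric on `𝒪(1)`
over the projective space, and its curvature form `(i/2π) ∂∂̄ log weight` has to be positive in all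
directions tangent to `X` (tangent to the cone and not radial). -/
structure PositiveMetric {N : ℕ} (X : Set (PSpace N)) where
  weight : Coord N → ℝ
  weight_pos : ∀ v, v ≠ 0 → 0 < weight v
  weight_smul : ∀ (a : ℂ) (v : Coord N), a ≠ 0 → v ≠ 0 → weight (a • v) = ‖a‖ ^ 2 * weight v
  smooth : ContDiffOn ℝ ∞ weight {v | v ≠ 0}
  positive : ∀ v ∈ cone X, ∀ ξ ∈ coneTangent X v, (¬ ∃ a : ℂ, ξ = a • v) →
    0 < leviForm (fun w => Real.log (weight w)) v ξ

/-- The elements of `H⁰(X, 𝒪(1)|_X)`: functions on the cone over `X`, homogeneous of degree one,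
that are locally quotients of homogeneous polynomials whose degrees differ by one.
(Values of `toFun` outside the cone play no role.) -/
structure GlobalSection {N : ℕ} (X : Set (PSpace N)) where
  toFun : Coord N → ℂ
  homogeneous : ∀ v ∈ cone X, ∀ a : ℂ, a ≠ 0 → toFun (a • v) = a * toFun v
  regular : ∀ v ∈ cone X, ∃ (d : ℕ) (F G : MvPolynomial (Fin (N + 1)) ℂ),
    F.IsHomogeneous (d + 1) ∧ G.IsHomogeneous d ∧ MvPolynomial.eval v G ≠ 0 ∧
    ∀ w ∈ cone X, MvPolynomial.eval w G ≠ 0 →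
      toFun w = MvPolynomial.eval w F / MvPolynomial.eval w G

/-- `φ : ℂ → ℙ^N` is holomorphic: near every point it is `[f₀ : ⋯ : f_N]` for holomorphic
functions `fᵢ` without common zeros. -/
def IsHolomorphic {N : ℕ} (φ : ℂ → PSpace N) : Prop :=
  ∀ z : ℂ, ∃ f : ℂ → Coord N, AnalyticAt ℂ f z ∧
    ∀ᶠ ζ in 𝓝 z, ∃ h : f ζ ≠ 0, φ ζ = Projectivization.mk ℂ (f ζ) h

/-- The lift of `φ` to coordinate vectors that is normalized by `⟨v, lift⟩ = 1`, where `v` are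
coordinates of `φ z`. If `φ` is holomorphic, this is a holomorphic nonvanishing lift of `φ` on a
neighbourhood of `z`. -/
def localLift {N : ℕ} (φ : ℂ → PSpace N) (z ζ : ℂ) : Coord N :=
  (star (φ z).rep ⬝ᵥ (φ ζ).rep)⁻¹ • (φ ζ).rep

/-- The density with respect to the Lebesgue measure of `φ^* c₁(M)`, where
`c₁(M) = (i/2π) ∂∂̄ log weight = - (i/2π) ∂∂̄ log ‖s‖²`, computed with a local holomorphic lift
of `φ` (the result does not depend on the lift). Note `(i/2) dt ∧ dt̄` is the Lebesgue measure. -/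
def chernDensity {N : ℕ} {X : Set (PSpace N)} (M : PositiveMetric X) (φ : ℂ → PSpace N)
    (z : ℂ) : ℝ :=
  (1 / Real.pi) * leviForm (fun w => Real.log (M.weight w))
    (localLift φ z z) (deriv (localLift φ z) z)

/-- The Nevanlinna characteristic function `T_{φ,M}(r) = ∫₀^r (1/t) ∫_{|z| < t} φ^* c₁(M) dt`. -/
def characteristic {N : ℕ} {X : Set (PSpace N)} (M : PositiveMetric X) (φ : ℂ → PSpace N)
    (r : ℝ) : ℝ :=
  ∫ t in (0 : ℝ)..r, (1 / t) * ∫ z in ball (0 : ℂ) t, chernDensity M φ z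

/-- The norm `‖φ^* s‖(z)`. -/
def sectionNorm {N : ℕ} {X : Set (PSpace N)} (M : PositiveMetric X) (φ : ℂ → PSpace N)
    (s : GlobalSection X) (z : ℂ) : ℝ :=
  ‖s.toFun (φ z).rep‖ / Real.sqrt (M.weight (φ z).rep)

/-- `‖s‖_r`, the supremum of `‖φ^* s‖(z)` over `|z| ≤ r`. -/
def supNorm {N : ℕ} {X : Set (PSpace N)} (M : PositiveMetric X) (φ : ℂ → PSpace N)
    (s : GlobalSection X) (r : ℝ) : ℝ :=
  sSup (sectionNorm M φ s '' closedBall (0 : ℂ) r)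

/-- `v_z(s)`, the multiplicity of the zero of `φ^* s` at `z`. -/
def multiplicity {N : ℕ} {X : Set (PSpace N)} (φ : ℂ → PSpace N) (s : GlobalSection X)
    (z : ℂ) : ℕ :=
  analyticOrderNatAt (fun ζ => s.toFun (localLift φ z ζ)) z

/-- The Green function `g_r(w₀, z) = log |(r² - z w̄₀) / (r (z - w₀))|` of the disk of radius `r`. -/
def green (r : ℝ) (w₀ z : ℂ) : ℝ :=
  Real.log ‖((r : ℂ) ^ 2 - z * star w₀) / ((r : ℂ) * (z - w₀))‖

end EntireCurve

end

/-!
The proof combines a Poisson–Jensen inequality with a Cartan type covering lemma.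

Along `φ`, the norm of a section is locally `|h| e^g` with `h` holomorphic and `Δ g = -2π d`, where
`d ≥ 0` is the density of `φ^* c₁(M)` (`isSectionNorm_sectionNorm`): the pulled back section is read
off in a holomorphic lift of `φ`, and another lift changes `log weight` by a harmonic function only.
After division by the Blaschke product of the zeros in a disk of radius `R < r`, the logarithm of
the norm is a `C²` function. Moving `w₀` to the centre by an automorphism of the disk and applying
Jensen's formula (`jensen_unitDisk`) bounds its value at `w₀` by its maximum on the circle plus the
Green potential `∫ g_R(w₀, z) d(z)`. This gives `IsSectionNorm.finsum_green_add_log_le`, in which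
only the Green potential remains to be estimated; it does not involve the section.

Let `n` be the mass of `d` on `Δ_r`, so that `n ≤ T(er)`. If `r T(r) < 5`, the disk `Δ_r` itself is
an admissible exceptional set. Otherwise put `κ = 13/20 T(r)`. By a Vitali covering, outside disks
of total radius at most `3/κ < 5/T(r)` every disk of radius `t` about `w₀` has mass at most `n κ t`
(`exists_disks_measure_closedBall_le`). Then `∫ log⁺ (1 / (κ |z - w₀|)) d(z) ≤ n`, and since
`g_R(w₀, z) ≤ log (r κ + 1 / (4 r κ)) + log⁺ (1 / (κ |z - w₀|))`, the Green potential is at most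
`n (log (r κ + 1 / (4 r κ)) + 1) ≤ n log (2 r T(r))`. The constants are tight enough to need the
factor `3` of the covering, instead of the usual `5`, and this sharp bound for `g_R`, instead of
`log (2 r / |z - w₀|)`.
-/

/-! ### Laplacians and holomorphic maps -/

namespace EntireCurve

open Laplacian

theorem laplacian_eq_fderiv_fderiv (g : ℂ → ℝ) (z : ℂ) :
    Δ g z = fderiv ℝ (fderiv ℝ g) z 1 1 +
      fderiv ℝ (fderiv ℝ g) z Complex.I Complex.I := by
  simp [InnerProductSpace.laplacian_eq_iteratedFDeriv_complexPlane, iteratedFDeriv_two_apply]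

/-- The trace of a real bilinear form on `ℂ` may be computed in the orthogonal basis `a, ia`;
no symmetry is needed since the two mixed terms cancel. -/
theorem bilinear_self_add_bilinear_I_mul_self (B : ℂ →L[ℝ] ℂ →L[ℝ] ℝ) (a : ℂ) :
    B a a + B (Complex.I * a) (Complex.I * a) =
      ‖a‖ ^ 2 * (B 1 1 + B Complex.I Complex.I) := by
  have h1 : a = a.re • (1 : ℂ) + a.im • Complex.I := by
    simp [Complex.re_add_im]
  have h2 : Complex.I * a = (-a.im) • (1 : ℂ) + a.re • Complex.I := by
    apply Complex.ext <;> simp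
  rw [h2]
  nth_rewrite 1 2 [h1]
  rw [← Complex.normSq_eq_norm_sq, Complex.normSq_apply]
  simp only [map_add, map_smul, _root_.add_apply, _root_.smul_apply,
    smul_eq_mul]
  ring

section Chain

variable {E : Type*} [NormedAddCommGroup E] [NormedSpace ℂ E] [NormedSpace ℝ E]
  [IsScalarTower ℝ ℂ E] [CompleteSpace E]

/-- The Laplacian of `u ∘ F` for a holomorphic `F`: the terms with `F''` cancel. -/
theorem laplacian_comp_analytic {u : E → ℝ} {F : ℂ → E} {z : ℂ}
    (hu : ContDiffAt ℝ 2 u (F z)) (hF : AnalyticAt ℂ F z) :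
    Δ (fun ζ => u (F ζ)) z = fderiv ℝ (fderiv ℝ u) (F z) (deriv F z) (deriv F z) +
      fderiv ℝ (fderiv ℝ u) (F z) (Complex.I • deriv F z) (Complex.I • deriv F z) := by
  have hFev : ∀ᶠ ζ in 𝓝 z, AnalyticAt ℂ F ζ := hF.eventually_analyticAt
  have huev : ∀ᶠ ζ in 𝓝 z, ContDiffAt ℝ 2 u (F ζ) :=
    hF.continuousAt.eventually (hu.eventually (by simp))
  have hFr : ∀ {G : ℂ → E} {ζ : ℂ}, AnalyticAt ℂ G ζ →
      HasFDerivAt G ((ContinuousLinearMap.toSpanSingleton ℂ (deriv G ζ)).restrictScalars ℝ) ζ :=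
    fun h => (h.differentiableAt.hasDerivAt.hasFDerivAt).restrictScalars ℝ
  have hg : ∀ w : ℂ, (fun ζ => fderiv ℝ (fun ζ => u (F ζ)) ζ w) =ᶠ[𝓝 z]
      fun ζ => fderiv ℝ u (F ζ) (w • deriv F ζ) := by
    intro w
    filter_upwards [hFev, huev] with ζ h1 h2
    have := ((h2.differentiableAt (by simp)).hasFDerivAt.comp ζ (hFr h1)).fderiv
    simp only [Function.comp_def] at this
    rw [this]
    simp
  have hu' : DifferentiableAt ℝ (fderiv ℝ u) (F z) :=
    (hu.fderiv_right (m := 1) (by norm_num)).differentiableAt (by simp)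
  have hk : ∀ w : ℂ, HasFDerivAt (fun ζ => fderiv ℝ (fun ζ => u (F ζ)) ζ w) _ z := fun w =>
    ((hu'.hasFDerivAt.comp z (hFr hF)).clm_apply
      ((hFr hF.deriv).const_smul w)).congr_of_eventuallyEq (hg w)
  have hd : DifferentiableAt ℝ (fderiv ℝ (fun ζ => u (F ζ))) z := by
    have h2 : ContDiffAt ℝ 2 (fun ζ => u (F ζ)) z :=
      hu.comp z (hF.contDiffAt.restrict_scalars ℝ)
    exact (h2.fderiv_right (m := 1) (by norm_num)).differentiableAt (by simp)
  have hw : ∀ w : ℂ, fderiv ℝ (fderiv ℝ (fun ζ => u (F ζ))) z w w =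
      fderiv ℝ (fderiv ℝ u) (F z) (w • deriv F z) (w • deriv F z) +
        fderiv ℝ u (F z) ((w * w) • deriv (deriv F) z) := by
    intro w
    have h3 := (hd.hasFDerivAt.clm_apply (hasFDerivAt_const w z)).unique (hk w)
    have := DFunLike.congr_fun h3 w
    simp at this
    rw [this, add_comm, smul_smul]
  rw [laplacian_eq_fderiv_fderiv, hw, hw]
  simp
  ring

end Chain

/-- The Levi form is the Hermitian part of the real Hessian. -/
theorem leviForm_eq {N : ℕ} {u : Coord N → ℝ} {v : Coord N} (ξ : Coord N)
    (hu : ContDiffAt ℝ 2 u v) :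
    leviForm u v ξ = 1 / 4 * (fderiv ℝ (fderiv ℝ u) v ξ ξ +
      fderiv ℝ (fderiv ℝ u) v (Complex.I • ξ) (Complex.I • ξ)) := by
  have hd : HasDerivAt (fun t : ℂ => v + t • ξ) ξ 0 := by
    simpa using ((hasDerivAt_id (0 : ℂ)).smul_const ξ).const_add v
  have ha : AnalyticAt ℂ (fun t : ℂ => v + t • ξ) 0 := by fun_prop
  have := laplacian_comp_analytic (u := u) (F := fun t : ℂ => v + t • ξ) (z := 0)
    (by simpa using hu) ha
  rw [hd.deriv] at this
  rw [leviForm, this]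
  simp

theorem laplacian_comp_eq_leviForm {N : ℕ} {u : Coord N → ℝ} {F : ℂ → Coord N} {z : ℂ}
    (hu : ContDiffAt ℝ 2 u (F z)) (hF : AnalyticAt ℂ F z) :
    Δ (fun ζ => u (F ζ)) z = 4 * leviForm u (F z) (deriv F z) := by
  rw [laplacian_comp_analytic hu hF, leviForm_eq _ hu]
  ring

/-- Conformal invariance of the Laplacian in the plane. -/
theorem laplacian_comp_analytic_complex {V : ℂ → ℝ} {ψ : ℂ → ℂ} {z : ℂ}
    (hV : ContDiffAt ℝ 2 V (ψ z)) (hψ : AnalyticAt ℂ ψ z) :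
    Δ (fun ζ => V (ψ ζ)) z = ‖deriv ψ z‖ ^ 2 * Δ V (ψ z) := by
  rw [laplacian_comp_analytic hV hψ, laplacian_eq_fderiv_fderiv, smul_eq_mul,
    bilinear_self_add_bilinear_I_mul_self]

end EntireCurve

/-! ### Jensen's formula for smooth functions on the unit disk -/

namespace EntireCurve

open Laplacian

/-- Differentiation under the integral sign over a compact interval, with a jointly continuous
derivative. -/
theorem hasDerivAt_intervalIntegral_of_continuous {f f' : ℝ → ℝ → ℝ} {a b : ℝ} (hab : a ≤ b)
    (hf : Continuous f.uncurry) (hf' : Continuous f'.uncurry)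
    (hd : ∀ t x, HasDerivAt (fun s => f s x) (f' t x) t) (t : ℝ) :
    HasDerivAt (fun s => ∫ x in a..b, f s x) (∫ x in a..b, f' t x) t := by
  obtain ⟨C, hC⟩ := ((isCompact_closedBall t 1).prod (isCompact_Icc (a := a) (b := b))).bddAbove_image
    (f := fun p : ℝ × ℝ => ‖f'.uncurry p‖) hf'.norm.continuousOn
  refine (intervalIntegral.hasDerivAt_integral_of_dominated_loc_of_deriv_le (s := closedBall t 1)
    (bound := fun _ => C) (closedBall_mem_nhds t one_pos) (.of_forall fun s => ?_) ?_ ?_ ?_ ?_ ?_).2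
  · exact (by fun_prop : Continuous (f s)).aestronglyMeasurable
  · exact (by fun_prop : Continuous (f t)).intervalIntegrable _ _
  · exact (by fun_prop : Continuous (f' t)).aestronglyMeasurable
  · refine .of_forall fun x hx s hs => hC ⟨(s, x), ⟨hs, ?_⟩, rfl⟩
    rw [uIoc_of_le hab] at hx
    exact Ioc_subset_Icc_self hx
  · exact intervalIntegrable_const
  · exact .of_forall fun x _ s _ => hd s x

/-- The one-dimensional form of Jensen's formula for a `C²` function on the plane. -/
theorem jensen_radial {W : ℂ → ℝ} (hW : ContDiff ℝ 2 W) :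
    ∫ θ in (-Real.pi)..Real.pi, W (Complex.exp (θ * Complex.I)) = 2 * Real.pi * W 0 +
      ∫ t in (0 : ℝ)..1, -(t * Real.log t) *
        ∫ θ in (-Real.pi)..Real.pi, Δ W (t * Complex.exp (θ * Complex.I)) := by
  have hD1 : ContDiff ℝ 1 (fderiv ℝ W) := hW.fderiv_right (by norm_num)
  have hc1 : Continuous (fderiv ℝ W) := hD1.continuous
  have hc2 : Continuous (fderiv ℝ (fderiv ℝ W)) := hD1.continuous_fderiv (by simp)
  have hcL : Continuous (Δ W) := by
    simp only [funext (laplacian_eq_fderiv_fderiv W)]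
    fun_prop
  set e : ℝ → ℂ := fun θ => Complex.exp (θ * Complex.I) with he
  have hec : Continuous e := by fun_prop
  have hpi : -Real.pi ≤ Real.pi := by linarith [Real.pi_pos]
  have hpt : ∀ t θ : ℝ, HasDerivAt (fun s : ℝ => (s : ℂ) * e θ) (e θ) t := fun t θ => by
    simpa using (Complex.ofRealCLM.hasDerivAt (x := t)).mul_const (e θ)
  have hpθ : ∀ θ : ℝ, HasDerivAt e (Complex.I * e θ) θ := fun θ => by
    have := ((Complex.ofRealCLM.hasDerivAt (x := θ)).mul_const Complex.I).cexp
    simpa [he, mul_comm] using this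
  set A := fun t : ℝ => ∫ θ in (-Real.pi)..Real.pi, W (t * e θ) with hA
  set A1 := fun t : ℝ => ∫ θ in (-Real.pi)..Real.pi, fderiv ℝ W (t * e θ) (e θ) with hA1
  set A2 := fun t : ℝ => ∫ θ in (-Real.pi)..Real.pi,
    fderiv ℝ (fderiv ℝ W) (t * e θ) (e θ) (e θ) with hA2
  have hWc : Continuous W := hW.continuous
  have dA : ∀ t, HasDerivAt A (A1 t) t := by
    refine hasDerivAt_intervalIntegral_of_continuous hpi (by fun_prop) (by fun_prop) ?_
    intro t θ
    exact ((hW.differentiable (by simp)) _).hasFDerivAt.comp_hasDerivAt t (hpt t θ)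
  have dA1 : ∀ t, HasDerivAt A1 (A2 t) t := by
    refine hasDerivAt_intervalIntegral_of_continuous hpi (by fun_prop) (by fun_prop) ?_
    intro t θ
    have := ((hD1.differentiable (by simp)) (t * e θ)).hasFDerivAt.comp_hasDerivAt t (hpt t θ)
    simpa using this.clm_apply (hasDerivAt_const t (e θ))
  -- the integral over the circle of an angular derivative vanishes
  have hang : ∀ t, A1 t = t * ∫ θ in (-Real.pi)..Real.pi,
      fderiv ℝ (fderiv ℝ W) (t * e θ) (Complex.I * e θ) (Complex.I * e θ) := by
    intro t
    have h1 : ∀ θ ∈ uIcc (-Real.pi) Real.pi,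
        HasDerivAt (fun θ : ℝ => fderiv ℝ W (t * e θ) (Complex.I * e θ))
        (t * fderiv ℝ (fderiv ℝ W) (t * e θ) (Complex.I * e θ) (Complex.I * e θ)
          - fderiv ℝ W (t * e θ) (e θ)) θ := by
      intro θ _
      have h2 := ((hD1.differentiable (by simp)) (t * e θ)).hasFDerivAt.comp_hasDerivAt θ
        ((hpθ θ).const_mul (t : ℂ))
      have h3 := h2.clm_apply ((hpθ θ).const_mul Complex.I)
      refine h3.congr_deriv ?_
      have h4 : (t : ℂ) * (Complex.I * e θ) = t • (Complex.I * e θ) := by simp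
      have h5 : Complex.I * (Complex.I * e θ) = - e θ := by
        rw [← mul_assoc, Complex.I_mul_I]; ring
      simp only [h4, h5, map_smul, map_neg, _root_.smul_apply, smul_eq_mul, sub_eq_add_neg,
        Function.comp_apply]
    have h2 := intervalIntegral.integral_eq_sub_of_hasDerivAt h1
      ((by fun_prop : Continuous _).intervalIntegrable _ _)
    rw [intervalIntegral.integral_sub ((by fun_prop : Continuous _).intervalIntegrable _ _)
      ((by fun_prop : Continuous _).intervalIntegrable _ _),
      intervalIntegral.integral_const_mul] at h2
    have h6 : e Real.pi = e (-Real.pi) := by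
      simp [he, Complex.exp_neg]
    rw [h6, sub_self] at h2
    simp only [hA1]
    linarith
  have hL : ∀ t, A1 t + t * A2 t =
      t * ∫ θ in (-Real.pi)..Real.pi, Δ W (t * e θ) := by
    intro t
    rw [hang, ← mul_add, hA2, ← intervalIntegral.integral_add
      ((by fun_prop : Continuous _).intervalIntegrable _ _)
      ((by fun_prop : Continuous _).intervalIntegrable _ _)]
    congr 1
    refine intervalIntegral.integral_congr fun θ _ => ?_
    have h1 : ‖e θ‖ = 1 := by simp [he, Complex.norm_exp_ofReal_mul_I]
    rw [add_comm, bilinear_self_add_bilinear_I_mul_self, h1, laplacian_eq_fderiv_fderiv]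
    ring
  have hA1c : Continuous A1 := continuous_iff_continuousAt.2 fun t => (dA1 t).continuousAt
  have hAc : Continuous A := continuous_iff_continuousAt.2 fun t => (dA t).continuousAt
  have hlog : Continuous fun t : ℝ => t * Real.log t := Real.continuous_mul_log
  -- `A - t log t A'` has the derivative `-log t (A' + t A'')`, and the values `A 0` and `A 1` at the
  -- end points
  have hfin := intervalIntegral.integral_eq_sub_of_hasDerivAt_of_le (a := 0) (b := 1)
    (f := fun t => A t - t * Real.log t * A1 t)
    (f' := fun t => -(t * Real.log t) * ∫ θ in (-Real.pi)..Real.pi, Δ W (t * e θ))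
    zero_le_one (by fun_prop) (by
      intro t ht
      refine ((dA t).sub ((Real.hasDerivAt_mul_log ht.1.ne').mul (dA1 t))).congr_deriv ?_
      have := hL t
      have h3 : A1 t - ((Real.log t + 1) * A1 t + t * Real.log t * A2 t) =
        -Real.log t * (A1 t + t * A2 t) := by ring
      rw [h3, this]
      ring)
    ((by fun_prop : Continuous _).intervalIntegrable _ _)
  rw [hfin]
  simp [hA]
  ring

/-- **Jensen's formula** for a function that is `C²` in a neighbourhood of the closed unit disk. -/
theorem jensen_unitDisk {W : ℂ → ℝ} (hW : ∀ z ∈ closedBall (0 : ℂ) 1, ContDiffAt ℝ 2 W z) :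
    ∫ θ in (-Real.pi)..Real.pi, W (Complex.exp (θ * Complex.I)) = 2 * Real.pi * W 0 +
      ∫ z in ball (0 : ℂ) 1, -Real.log ‖z‖ * Δ W z := by
  -- a cutoff reduces to a function that is `C²` on the whole plane
  obtain ⟨W', hW', hWW'⟩ : ∃ W' : ℂ → ℝ, ContDiff ℝ 2 W' ∧
      ∀ z ∈ closedBall (0 : ℂ) 1, W' =ᶠ[𝓝 z] W := by
    have hU : IsOpen {z : ℂ | ContDiffAt ℝ 2 W z} :=
      isOpen_iff_mem_nhds.2 fun z hz => ContDiffAt.eventually hz (by simp)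
    obtain ⟨δ, hδ, hδU⟩ := (isCompact_closedBall (0 : ℂ) 1).exists_cthickening_subset_open hU hW
    rw [cthickening_closedBall hδ.le zero_le_one] at hδU
    let χ : ContDiffBump (0 : ℂ) := ⟨1 + δ / 3, 1 + δ / 2, by positivity, by linarith⟩
    refine ⟨fun z => χ z * W z, contDiff_iff_contDiffAt.2 fun z => ?_, fun z hz => ?_⟩
    · by_cases hz : z ∈ ball (0 : ℂ) (1 + δ)
      · exact χ.contDiffAt.mul (hδU (by simpa [add_comm] using ball_subset_closedBall hz))
      · have : z ∈ (closedBall (0 : ℂ) (1 + δ / 2))ᶜ := by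
          simp only [mem_ball, mem_compl_iff, mem_closedBall] at hz ⊢
          intro h; apply hz; linarith
        have h0 : (fun z => χ z * W z) =ᶠ[𝓝 z] fun _ => 0 := by
          filter_upwards [isClosed_closedBall.isOpen_compl.mem_nhds this] with y hy
          have : χ y = 0 := χ.zero_of_le_dist (by
            simp only [mem_compl_iff, mem_closedBall, not_le] at hy; exact hy.le)
          simp [this]
        exact contDiffAt_const.congr_of_eventuallyEq h0
    · have : z ∈ ball (0 : ℂ) (1 + δ / 3) := by
        simp only [mem_ball, mem_closedBall] at hz ⊢
        linarith
      filter_upwards [isOpen_ball.mem_nhds this] with y hy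
      have : χ y = 1 := χ.one_of_mem_closedBall (ball_subset_closedBall hy)
      simp [this]
  have hcL : Continuous (Δ W') := by
    have hD1 : ContDiff ℝ 1 (fderiv ℝ W') := hW'.fderiv_right (by norm_num)
    have hc2 : Continuous (fderiv ℝ (fderiv ℝ W')) := hD1.continuous_fderiv (by simp)
    simp only [funext (laplacian_eq_fderiv_fderiv W')]
    fun_prop
  have h1 : ∫ θ in (-Real.pi)..Real.pi, W (Complex.exp (θ * Complex.I)) =
      ∫ θ in (-Real.pi)..Real.pi, W' (Complex.exp (θ * Complex.I)) := by
    refine intervalIntegral.integral_congr fun θ _ => ((hWW' _ ?_).eq_of_nhds).symm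
    simp [Complex.norm_exp_ofReal_mul_I]
  have h2 : ∫ z in ball (0 : ℂ) 1, -Real.log ‖z‖ * Δ W z =
      ∫ z in ball (0 : ℂ) 1, -Real.log ‖z‖ * Δ W' z := by
    refine setIntegral_congr_fun measurableSet_ball fun z hz => ?_
    rw [InnerProductSpace.laplacian_congr_nhds (hWW' z (ball_subset_closedBall hz)) |>.eq_of_nhds]
  rw [h1, h2, jensen_radial hW', ← (hWW' 0 (by simp)).eq_of_nhds]
  congr 1
  have hpi : -Real.pi ≤ Real.pi := by linarith [Real.pi_pos]
  rw [← integral_indicator measurableSet_ball, ← Complex.integral_comp_polarCoord_symm]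
  have hlog : Continuous fun t : ℝ => t * Real.log t := Real.continuous_mul_log
  set G : ℝ × ℝ → ℝ := fun p => -(p.1 * Real.log p.1) *
    Δ W' (p.1 * Complex.exp (p.2 * Complex.I)) with hG
  have hGc : Continuous G := by
    have : Continuous fun p : ℝ × ℝ => p.1 * Real.log p.1 := hlog.comp continuous_fst
    fun_prop
  have hset : polarCoord.target = Ioi (0 : ℝ) ×ˢ Ioo (-Real.pi) Real.pi := rfl
  have h3 : ∫ p in polarCoord.target, p.1 • (ball (0 : ℂ) 1).indicator
      (fun z => -Real.log ‖z‖ * Δ W' z) (Complex.polarCoord.symm p) =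
      ∫ p in Ioo (0 : ℝ) 1 ×ˢ Ioo (-Real.pi) Real.pi, G p := by
    have hsub : Ioo (0 : ℝ) 1 ×ˢ Ioo (-Real.pi) Real.pi ⊆ polarCoord.target := by
      rw [hset]; exact prod_mono (fun _ h => h.1) le_rfl
    have hEq : EqOn (fun p : ℝ × ℝ => p.1 • (ball (0 : ℂ) 1).indicator
        (fun z => -Real.log ‖z‖ * Δ W' z) (Complex.polarCoord.symm p))
        ((Ioo (0 : ℝ) 1 ×ˢ Ioo (-Real.pi) Real.pi).indicator G) polarCoord.target := by
      rintro ⟨t, θ⟩ hp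
      rw [hset] at hp
      have ht : 0 < t := hp.1
      have hn : ‖Complex.polarCoord.symm (t, θ)‖ = t := by
        rw [Complex.norm_polarCoord_symm, abs_of_pos ht]
      have hv : Complex.polarCoord.symm (t, θ) = t * Complex.exp (θ * Complex.I) := by
        rw [Complex.polarCoord_symm_apply, Complex.exp_mul_I]; simp
      by_cases h : t < 1
      · have hmem : (t, θ) ∈ Ioo (0 : ℝ) 1 ×ˢ Ioo (-Real.pi) Real.pi := ⟨⟨ht, h⟩, hp.2⟩
        rw [indicator_of_mem hmem]
        simp only
        rw [indicator_of_mem (by rw [mem_ball_zero_iff, hn]; exact h), hn, hv]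
        simp only [hG, smul_eq_mul]
        ring
      · rw [indicator_of_notMem (fun h' => h h'.1.2)]
        simp only
        rw [indicator_of_notMem (by rw [mem_ball_zero_iff, hn]; exact h), smul_zero]
    rw [setIntegral_congr_fun polarCoord.open_target.measurableSet hEq,
      setIntegral_indicator (measurableSet_Ioo.prod measurableSet_Ioo),
      inter_eq_self_of_subset_right hsub]
  rw [h3, Measure.volume_eq_prod, setIntegral_prod]
  · rw [intervalIntegral.integral_of_le zero_le_one, integral_Ioc_eq_integral_Ioo]
    refine setIntegral_congr_fun measurableSet_Ioo fun t _ => ?_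
    rw [← integral_Ioc_eq_integral_Ioo, ← intervalIntegral.integral_of_le hpi, hG]
    simp only [intervalIntegral.integral_const_mul]
  · refine (hGc.continuousOn.integrableOn_compact
      ((isCompact_Icc (a := (0 : ℝ)) (b := 1)).prod
        (isCompact_Icc (a := -Real.pi) (b := Real.pi)))).mono_set ?_
    exact prod_mono Ioo_subset_Icc_self Ioo_subset_Icc_self

end EntireCurve

/-! ### The Green function of a disk -/

namespace EntireCurve

open Laplacian

theorem det_restrictScalars_toSpanSingleton (a : ℂ) :
    ((ContinuousLinearMap.toSpanSingleton ℂ a).restrictScalars ℝ : ℂ →L[ℝ] ℂ).det = ‖a‖ ^ 2 := by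
  rw [← Complex.normSq_eq_norm_sq, ← Algebra.norm_complex_apply, Algebra.norm_apply]
  unfold ContinuousLinearMap.det
  congr 1
  ext
  simp [mul_comm]

/-- The automorphism `ζ ↦ R (R ζ + w) / (R + w̄ ζ)` mapping the unit disk onto the disk of radius
`R`, and `0` to `w`. -/
noncomputable def diskMap (R : ℝ) (w ζ : ℂ) : ℂ := R * (R * ζ + w) / (R + star w * ζ)

/-- The inverse `z ↦ R (z - w) / (R² - z w̄)` of `diskMap R w`. -/
noncomputable def diskMapInv (R : ℝ) (w z : ℂ) : ℂ := R * (z - w) / ((R : ℂ) ^ 2 - z * star w)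

section DiskMap

variable {R : ℝ} {w : ℂ}

theorem green_eq_neg_log (R : ℝ) (w z : ℂ) : green R w z = -Real.log ‖diskMapInv R w z‖ := by
  rw [green, diskMapInv, ← Real.log_inv, ← norm_inv, inv_div]

theorem normSq_identity (R : ℝ) (w ζ : ℂ) :
    ‖(R : ℂ) + star w * ζ‖ ^ 2 - ‖(R : ℂ) * ζ + w‖ ^ 2 = (R ^ 2 - ‖w‖ ^ 2) * (1 - ‖ζ‖ ^ 2) := by
  simp only [← Complex.normSq_eq_norm_sq, Complex.normSq_apply]
  simp
  ring

theorem normSq_identity_inv (R : ℝ) (w z : ℂ) :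
    ‖(R : ℂ) ^ 2 - z * star w‖ ^ 2 - ‖(R : ℂ) * (z - w)‖ ^ 2 =
      (R ^ 2 - ‖w‖ ^ 2) * (R ^ 2 - ‖z‖ ^ 2) := by
  simp only [← Complex.normSq_eq_norm_sq, Complex.normSq_apply]
  simp [pow_two]
  ring

theorem diskMap_denom_ne_zero (hw : ‖w‖ < R) {ζ : ℂ} (hζ : ‖ζ‖ ≤ 1) :
    (R : ℂ) + star w * ζ ≠ 0 := by
  intro h
  have h1 : ‖(R : ℂ)‖ = ‖star w * ζ‖ := by rw [eq_neg_of_add_eq_zero_left h, norm_neg]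
  have hR : 0 < R := (norm_nonneg w).trans_lt hw
  rw [norm_mul, norm_star, Complex.norm_real, Real.norm_of_nonneg hR.le] at h1
  nlinarith [norm_nonneg w]

theorem diskMapInv_denom_ne_zero (hw : ‖w‖ < R) {z : ℂ} (hz : ‖z‖ ≤ R) :
    (R : ℂ) ^ 2 - z * star w ≠ 0 := by
  intro h
  have h1 : ‖(R : ℂ) ^ 2‖ = ‖z * star w‖ := by rw [sub_eq_zero.1 h]
  have hR : 0 < R := (norm_nonneg w).trans_lt hw
  rw [norm_mul, norm_star, norm_pow, Complex.norm_real, Real.norm_of_nonneg hR.le] at h1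
  nlinarith [norm_nonneg w, mul_le_mul_of_nonneg_right hz (norm_nonneg w)]

theorem diskMapInv_diskMap (hw : ‖w‖ < R) {ζ : ℂ} (hζ : ‖ζ‖ ≤ 1) :
    diskMapInv R w (diskMap R w ζ) = ζ := by
  have hR : 0 < R := (norm_nonneg w).trans_lt hw
  have h1 := diskMap_denom_ne_zero hw hζ
  have h2 : (R : ℂ) ≠ 0 := by exact_mod_cast hR.ne'
  have h3 : (R : ℂ) ^ 2 - w * star w ≠ 0 := diskMapInv_denom_ne_zero hw hw.le
  have hD : diskMap R w ζ * (R + star w * ζ) = R * (R * ζ + w) := by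
    rw [diskMap, div_mul_cancel₀ _ h1]
  have h4 : (R : ℂ) * (diskMap R w ζ - w) * (R + star w * ζ) =
      R * ζ * ((R : ℂ) ^ 2 - w * star w) := by
    linear_combination (R : ℂ) * hD
  have h5 : ((R : ℂ) ^ 2 - diskMap R w ζ * star w) * (R + star w * ζ) =
      R * ((R : ℂ) ^ 2 - w * star w) := by
    linear_combination (-star w) * hD
  rw [diskMapInv, ← mul_div_mul_right _ _ h1, h4, h5, mul_right_comm,
    mul_div_cancel_left₀ _ (mul_ne_zero h2 h3)]

theorem diskMap_diskMapInv (hw : ‖w‖ < R) {z : ℂ} (hz : ‖z‖ ≤ R) :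
    diskMap R w (diskMapInv R w z) = z := by
  have hR : 0 < R := (norm_nonneg w).trans_lt hw
  have h1 := diskMapInv_denom_ne_zero hw hz
  have h2 : (R : ℂ) ≠ 0 := by exact_mod_cast hR.ne'
  have h3 : (R : ℂ) ^ 2 - w * star w ≠ 0 := diskMapInv_denom_ne_zero hw hw.le
  have hD : diskMapInv R w z * ((R : ℂ) ^ 2 - z * star w) = R * (z - w) := by
    rw [diskMapInv, div_mul_cancel₀ _ h1]
  have h4 : (R : ℂ) * (R * diskMapInv R w z + w) * ((R : ℂ) ^ 2 - z * star w) =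
      R * ((R : ℂ) ^ 2 - w * star w) * z := by
    linear_combination (R : ℂ) ^ 2 * hD
  have h5 : (R + star w * diskMapInv R w z) * ((R : ℂ) ^ 2 - z * star w) =
      R * ((R : ℂ) ^ 2 - w * star w) := by
    linear_combination star w * hD
  rw [diskMap, ← mul_div_mul_right _ _ h1, h4, h5,
    mul_div_cancel_left₀ _ (mul_ne_zero h2 h3)]

theorem norm_diskMap_le (hw : ‖w‖ < R) {ζ : ℂ} (hζ : ‖ζ‖ ≤ 1) : ‖diskMap R w ζ‖ ≤ R := by
  have hR : 0 < R := (norm_nonneg w).trans_lt hw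
  have h1 := norm_pos_iff.2 (diskMap_denom_ne_zero hw hζ)
  have h2 := normSq_identity R w ζ
  have h3 : 0 ≤ (R ^ 2 - ‖w‖ ^ 2) * (1 - ‖ζ‖ ^ 2) := by
    apply mul_nonneg <;> nlinarith [norm_nonneg w, norm_nonneg ζ]
  rw [diskMap, norm_div, norm_mul, Complex.norm_real, Real.norm_of_nonneg hR.le, div_le_iff₀ h1]
  gcongr
  exact abs_le_of_sq_le_sq' (by linarith) h1.le |>.2

theorem norm_diskMap_lt (hw : ‖w‖ < R) {ζ : ℂ} (hζ : ‖ζ‖ < 1) : ‖diskMap R w ζ‖ < R := by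
  have hR : 0 < R := (norm_nonneg w).trans_lt hw
  have h1 := norm_pos_iff.2 (diskMap_denom_ne_zero hw hζ.le)
  have h2 := normSq_identity R w ζ
  have h3 : 0 < (R ^ 2 - ‖w‖ ^ 2) * (1 - ‖ζ‖ ^ 2) := by
    apply mul_pos <;> nlinarith [norm_nonneg w, norm_nonneg ζ]
  rw [diskMap, norm_div, norm_mul, Complex.norm_real, Real.norm_of_nonneg hR.le, div_lt_iff₀ h1]
  gcongr
  exact lt_of_pow_lt_pow_left₀ 2 h1.le (by linarith)

theorem norm_diskMapInv_lt (hw : ‖w‖ < R) {z : ℂ} (hz : ‖z‖ < R) : ‖diskMapInv R w z‖ < 1 := by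
  have h1 := norm_pos_iff.2 (diskMapInv_denom_ne_zero hw hz.le)
  have h2 := normSq_identity_inv R w z
  have h3 : 0 < (R ^ 2 - ‖w‖ ^ 2) * (R ^ 2 - ‖z‖ ^ 2) := by
    apply mul_pos <;> nlinarith [norm_nonneg w, norm_nonneg z]
  rw [diskMapInv, norm_div, div_lt_one h1]
  exact lt_of_pow_lt_pow_left₀ 2 h1.le (by linarith)

theorem norm_diskMapInv_of_norm_eq (hw : ‖w‖ < R) {z : ℂ} (hz : ‖z‖ = R) :
    ‖diskMapInv R w z‖ = 1 := by
  have h1 := norm_pos_iff.2 (diskMapInv_denom_ne_zero hw hz.le)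
  have h2 := normSq_identity_inv R w z
  rw [hz, sub_self, mul_zero] at h2
  rw [diskMapInv, norm_div, div_eq_one_iff_eq h1.ne']
  exact (pow_left_inj₀ (norm_nonneg _) h1.le two_ne_zero).1 (by linarith)

theorem norm_diskMap_of_norm_eq (hw : ‖w‖ < R) {ζ : ℂ} (hζ : ‖ζ‖ = 1) : ‖diskMap R w ζ‖ = R := by
  refine (norm_diskMap_le hw hζ.le).antisymm (not_lt.1 fun h => ?_)
  have := norm_diskMapInv_lt hw h
  rw [diskMapInv_diskMap hw hζ.le, hζ] at this
  exact lt_irrefl _ this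

theorem diskMap_image_ball (hw : ‖w‖ < R) : diskMap R w '' ball 0 1 = ball 0 R := by
  ext z
  simp only [mem_image, mem_ball_zero_iff]
  exact ⟨fun ⟨ζ, h, e⟩ => e ▸ norm_diskMap_lt hw h,
    fun h => ⟨_, norm_diskMapInv_lt hw h, diskMap_diskMapInv hw h.le⟩⟩

theorem analyticAt_diskMap (hw : ‖w‖ < R) {ζ : ℂ} (hζ : ‖ζ‖ ≤ 1) :
    AnalyticAt ℂ (diskMap R w) ζ := by
  unfold diskMap
  exact AnalyticAt.div (by fun_prop) (by fun_prop) (diskMap_denom_ne_zero hw hζ)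

theorem analyticAt_diskMapInv (hw : ‖w‖ < R) {z : ℂ} (hz : ‖z‖ ≤ R) :
    AnalyticAt ℂ (diskMapInv R w) z := by
  unfold diskMapInv
  exact AnalyticAt.div (by fun_prop) (by fun_prop) (diskMapInv_denom_ne_zero hw hz)

theorem diskMapInv_eq_zero_iff (hw : ‖w‖ < R) {z : ℂ} (hz : ‖z‖ ≤ R) :
    diskMapInv R w z = 0 ↔ z = w := by
  have hR : (R : ℂ) ≠ 0 := by exact_mod_cast ((norm_nonneg w).trans_lt hw).ne'
  rw [diskMapInv, div_eq_zero_iff, or_iff_left (diskMapInv_denom_ne_zero hw hz), mul_eq_zero,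
    or_iff_right hR, sub_eq_zero]

end DiskMap

/-- A Poisson–Jensen inequality: a function bounded by `C` on the circle is bounded inside the disk
by `C` plus the Green potential of its negative Laplacian. -/
theorem le_add_integral_green {V d : ℂ → ℝ} {R C : ℝ} {w : ℂ} (hw : ‖w‖ < R)
    (hV : ∀ z ∈ closedBall (0 : ℂ) R, ContDiffAt ℝ 2 V z)
    (hC : ∀ z ∈ sphere (0 : ℂ) R, V z ≤ C)
    (hd : ∀ z ∈ ball (0 : ℂ) R, Δ V z = -(2 * Real.pi) * d z) :
    V w ≤ C + ∫ z in ball (0 : ℂ) R, green R w z * d z := by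
  have hR : 0 < R := (norm_nonneg w).trans_lt hw
  have hpi : -Real.pi ≤ Real.pi := by linarith [Real.pi_pos]
  have hmem : ∀ {ζ : ℂ}, ‖ζ‖ ≤ 1 → diskMap R w ζ ∈ closedBall (0 : ℂ) R := fun h =>
    mem_closedBall_zero_iff.2 (norm_diskMap_le hw h)
  have hW : ∀ ζ ∈ closedBall (0 : ℂ) 1, ContDiffAt ℝ 2 (fun ζ => V (diskMap R w ζ)) ζ := by
    intro ζ hζ
    rw [mem_closedBall_zero_iff] at hζ
    exact (hV _ (hmem hζ)).comp ζ ((analyticAt_diskMap hw hζ).contDiffAt.restrict_scalars ℝ)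
  have hJ := jensen_unitDisk hW
  have h0 : diskMap R w 0 = w := by
    have : (R : ℂ) ≠ 0 := by exact_mod_cast hR.ne'
    simp [diskMap, this]
  have hnorm : ∀ θ : ℝ, ‖Complex.exp (θ * Complex.I)‖ = 1 := Complex.norm_exp_ofReal_mul_I
  have hle : ∫ θ in (-Real.pi)..Real.pi, V (diskMap R w (Complex.exp (θ * Complex.I))) ≤
      2 * Real.pi * C := by
    have hcont : Continuous fun θ : ℝ => V (diskMap R w (Complex.exp (θ * Complex.I))) :=
      continuous_iff_continuousAt.2 fun θ =>
        ContinuousAt.comp (f := fun θ : ℝ => Complex.exp (θ * Complex.I))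
          (hW _ (by simp [hnorm])).continuousAt (by fun_prop)
    refine (intervalIntegral.integral_mono_on hpi (hcont.intervalIntegrable _ _)
      (intervalIntegrable_const (c := C)) fun θ _ => hC _ ?_).trans ?_
    · exact mem_sphere_zero_iff_norm.2 (norm_diskMap_of_norm_eq hw (hnorm θ))
    · simp; linarith
  have hint : ∫ ζ in ball (0 : ℂ) 1, -Real.log ‖ζ‖ * Δ (fun ζ => V (diskMap R w ζ)) ζ =
      -(2 * Real.pi) * ∫ z in ball (0 : ℂ) R, green R w z * d z := by
    rw [← diskMap_image_ball hw, integral_image_eq_integral_abs_det_fderiv_smul volume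
      measurableSet_ball
      (f' := fun ζ => (ContinuousLinearMap.toSpanSingleton ℂ (deriv (diskMap R w) ζ)).restrictScalars
        ℝ) (fun ζ hζ => ?_) (fun x hx y hy hxy => ?_), ← integral_const_mul]
    · refine setIntegral_congr_fun measurableSet_ball fun ζ hζ => ?_
      rw [mem_ball_zero_iff] at hζ
      rw [laplacian_comp_analytic_complex (hV _ (hmem hζ.le)) (analyticAt_diskMap hw hζ.le),
        hd _ (mem_ball_zero_iff.2 (norm_diskMap_lt hw hζ)), det_restrictScalars_toSpanSingleton,
        green_eq_neg_log, diskMapInv_diskMap hw hζ.le, abs_of_nonneg (by positivity), smul_eq_mul]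
      ring
    · rw [mem_ball_zero_iff] at hζ
      exact ((analyticAt_diskMap hw hζ.le).differentiableAt.hasDerivAt.hasFDerivAt.restrictScalars
        ℝ).hasFDerivWithinAt
    · rw [mem_ball_zero_iff] at hx hy
      rw [← diskMapInv_diskMap hw hx.le, hxy, diskMapInv_diskMap hw hy.le]
  rw [hint] at hJ
  simp only [h0] at hJ
  have h2 : 2 * Real.pi * V w ≤ 2 * Real.pi * (C + ∫ z in ball (0 : ℂ) R, green R w z * d z) := by
    linarith
  exact le_of_mul_le_mul_left h2 (by positivity)

end EntireCurve

/-! ### Logarithmic potentials outside a union of small disks -/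

namespace EntireCurve

open scoped Real

/-- A Cartan type lemma: outside countably many disks with small radii, a measure of mass `n` has
at most linear concentration `μ(D(w,t)) ≤ l t`. -/
theorem exists_disks_measure_closedBall_le (μ : Measure ℂ) {n l : ℝ} (hl : 0 < l)
    (hμ : μ univ ≤ ENNReal.ofReal n) :
    ∃ (c : ℕ → ℂ) (ρ : ℕ → ℝ≥0), ∑' i, (ρ i : ℝ≥0∞) ≤ ENNReal.ofReal (3 * (n / l)) ∧
      ∀ w ∉ ⋃ i, ball (c i) (ρ i), ∀ t : ℝ, 0 < t →
        μ (closedBall w t) ≤ ENNReal.ofReal (l * t) := by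
  set S : Set (ℂ × ℝ) := {p | 0 < p.2 ∧ ENNReal.ofReal (l * p.2) < μ (closedBall p.1 p.2)} with hS
  have hSle : ∀ p ∈ S, p.2 ≤ n / l := by
    intro p hp
    have h1 := hp.2.trans_le ((measure_mono (subset_univ _)).trans hμ)
    rw [ENNReal.ofReal_lt_ofReal_iff_of_nonneg (by have := hp.1; positivity)] at h1
    rw [le_div_iff₀ hl]
    linarith
  obtain ⟨u, huS, hdisj, hcov⟩ := Vitali.exists_disjoint_subfamily_covering_enlargement
    (fun p : ℂ × ℝ => closedBall p.1 p.2) S (fun p => p.2) (3 / 2) (by norm_num)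
    (fun p hp => hp.1.le) (n / l) hSle (fun p hp => nonempty_closedBall.2 hp.1.le)
  have hu : u.Countable := hdisj.countable_of_nonempty_interior fun p hp =>
    (nonempty_ball.2 (huS hp).1).mono ball_subset_interior_closedBall
  have hsum : ∑' p : u, ENNReal.ofReal (3 * p.1.2) ≤ ENNReal.ofReal (3 * (n / l)) := by
    have h1 : ∑' p : u, ENNReal.ofReal (l * p.1.2) ≤ ENNReal.ofReal n := by
      calc ∑' p : u, ENNReal.ofReal (l * p.1.2)
          ≤ ∑' p : u, μ (closedBall p.1.1 p.1.2) :=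
            ENNReal.tsum_le_tsum fun p => (huS p.2).2.le
        _ = μ (⋃ p ∈ u, closedBall p.1 p.2) :=
            (measure_biUnion hu hdisj fun _ _ => isClosed_closedBall.measurableSet).symm
        _ ≤ _ := (measure_mono (subset_univ _)).trans hμ
    have h2 : ∀ x : ℝ, ENNReal.ofReal (3 * x) = ENNReal.ofReal (3 / l) * ENNReal.ofReal (l * x) := by
      intro x
      rw [← ENNReal.ofReal_mul (by positivity)]
      congr 1
      field_simp
    rw [h2 (n / l), mul_div_cancel₀ _ hl.ne']
    simp only [h2, ENNReal.tsum_mul_left]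
    gcongr
  have := hu.to_subtype
  obtain ⟨e, he⟩ := exists_injective_nat u
  refine ⟨Function.extend e (fun p => p.1.1) 0,
    Function.extend e (fun p => Real.toNNReal (3 * p.1.2)) 0, ?_, fun w hw t ht => ?_⟩
  · refine le_trans (le_of_eq ?_) hsum
    rw [← tsum_extend_zero he]
    refine tsum_congr fun i => ?_
    by_cases hi : ∃ p, e p = i
    · obtain ⟨p, rfl⟩ := hi
      simp [he.extend_apply, ENNReal.ofReal]
    · simp [Function.extend_apply' _ _ _ hi]
  · by_contra hlt
    obtain ⟨b, hb, ⟨y, hya, hyb⟩, hle⟩ := hcov (w, t) ⟨ht, not_le.1 hlt⟩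
    refine hw (mem_iUnion.2 ⟨e ⟨b, hb⟩, ?_⟩)
    have hb0 := (huS hb).1
    rw [he.extend_apply, he.extend_apply, mem_ball, Real.coe_toNNReal _ (by positivity)]
    simp only [mem_closedBall] at hya hyb hle
    calc dist w b.1 ≤ dist y w + dist y b.1 := dist_triangle_left _ _ _
      _ < 3 * b.2 := by linarith

/-- Linear concentration at `w` bounds the logarithmic potential of `μ` at `w`. -/
theorem lintegral_posLog_le {μ : Measure ℂ} {n κ : ℝ} {w : ℂ} (hn : 0 ≤ n) (hκ : 0 < κ)
    (h : ∀ t : ℝ, 0 < t → μ (closedBall w t) ≤ ENNReal.ofReal (n * κ * t)) :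
    ∫⁻ z, ENNReal.ofReal (log⁺ (κ * ‖z - w‖)⁻¹) ∂μ ≤ ENNReal.ofReal n := by
  have hmeas : Measurable fun z : ℂ => log⁺ (κ * ‖z - w‖)⁻¹ :=
    Real.continuous_posLog.measurable.comp (by fun_prop)
  rw [lintegral_eq_lintegral_meas_lt μ (.of_forall fun _ => Real.posLog_nonneg)
    hmeas.aemeasurable]
  have hexp : ∫⁻ s in Ioi (0 : ℝ), ENNReal.ofReal (n * Real.exp (-s)) = ENNReal.ofReal n := by
    rw [← ofReal_integral_eq_lintegral_ofReal ((integrableOn_exp_neg_Ioi 0).const_mul n)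
      (.of_forall fun _ => by positivity), integral_const_mul, integral_exp_neg_Ioi_zero, mul_one]
  rw [← hexp]
  refine setLIntegral_mono (by fun_prop) fun s hs => ?_
  have hs : 0 < s := hs
  calc μ {z | s < log⁺ (κ * ‖z - w‖)⁻¹} ≤ μ (closedBall w (Real.exp (-s) / κ)) := by
        refine measure_mono fun z hz => ?_
        have hz : s < log⁺ (κ * ‖z - w‖)⁻¹ := hz
        rw [mem_closedBall_iff_norm, le_div_iff₀ hκ]
        rw [Real.posLog_apply, lt_max_iff, or_iff_right hs.not_gt] at hz
        have hpos : 0 < κ * ‖z - w‖ := by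
          refine (by positivity : 0 ≤ κ * ‖z - w‖).lt_of_ne' fun h0 => ?_
          rw [h0] at hz
          simp at hz
          linarith
        rw [Real.log_inv] at hz
        rw [← Real.log_le_iff_le_exp (by linarith), mul_comm]
        linarith
    _ ≤ ENNReal.ofReal (n * κ * (Real.exp (-s) / κ)) := h _ (by positivity)
    _ = _ := by congr 1; field_simp

/-- The crude bound `g_R(w, z) ≤ log (2R / |z - w|)` would lose too much; the largest value of `g_R`
at a given distance `t = |z - w|` is attained at opposite points. -/
theorem green_le_log {R : ℝ} {w z : ℂ} (hw : ‖w‖ < R) (hz : ‖z‖ < R) (hne : z ≠ w) :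
    green R w z ≤ Real.log (R / ‖z - w‖ + ‖z - w‖ / (4 * R)) := by
  have hR : 0 < R := (norm_nonneg w).trans_lt hw
  have ht : 0 < ‖z - w‖ := norm_pos_iff.2 (sub_ne_zero.2 hne)
  have h1 := norm_pos_iff.2 (diskMapInv_denom_ne_zero hw hz.le)
  have h2 := normSq_identity_inv R w z
  have hden : ‖(R : ℂ) * (z - w)‖ = R * ‖z - w‖ := by
    rw [norm_mul, Complex.norm_real, Real.norm_of_nonneg hR.le]
  rw [hden] at h2
  have h3 : ‖z - w‖ ^ 2 ≤ 2 * (‖z‖ ^ 2 + ‖w‖ ^ 2) := by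
    have := norm_sub_le z w
    nlinarith [sq_nonneg (‖z‖ - ‖w‖), norm_nonneg z, norm_nonneg w]
  have h4 : ‖(R : ℂ) ^ 2 - z * star w‖ ≤ R ^ 2 + ‖z - w‖ ^ 2 / 4 := by
    refine (abs_le_of_sq_le_sq' ?_ (by positivity)).2
    have h5 : (R ^ 2 - ‖w‖ ^ 2) * (R ^ 2 - ‖z‖ ^ 2) ≤ (R ^ 2 - (‖z‖ ^ 2 + ‖w‖ ^ 2) / 2) ^ 2 := by
      nlinarith [sq_nonneg (‖z‖ ^ 2 - ‖w‖ ^ 2)]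
    have h6 : (R ^ 2 - (‖z‖ ^ 2 + ‖w‖ ^ 2) / 2) ^ 2 ≤ (R ^ 2 - ‖z - w‖ ^ 2 / 4) ^ 2 := by
      apply pow_le_pow_left₀
      · nlinarith [norm_nonneg z, norm_nonneg w]
      · linarith
    nlinarith
  rw [green, norm_div, hden]
  apply Real.log_le_log (by positivity)
  rw [div_le_iff₀ (by positivity)]
  calc _ ≤ _ := h4
    _ = _ := by field_simp

theorem green_nonneg {R : ℝ} {w z : ℂ} (hw : ‖w‖ < R) (hz : ‖z‖ < R) : 0 ≤ green R w z := by
  rw [green_eq_neg_log, neg_nonneg]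
  exact Real.log_nonpos (norm_nonneg _) (norm_diskMapInv_lt hw hz).le

theorem green_le_log_add_posLog {R r κ : ℝ} {w z : ℂ} (hw : ‖w‖ < R) (hz : ‖z‖ < R) (hRr : R ≤ r)
    (hκ : 0 < κ) (hκr : 3 ≤ r * κ) :
    green R w z ≤ Real.log (r * κ + 1 / (4 * (r * κ))) + log⁺ (κ * ‖z - w‖)⁻¹ := by
  have hR : 0 < R := (norm_nonneg w).trans_lt hw
  have hr : 0 < r := hR.trans_le hRr
  set K := r * κ + 1 / (4 * (r * κ)) with hK
  have hK1 : 1 ≤ K := by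
    have : 0 < 1 / (4 * (r * κ)) := by positivity
    linarith
  by_cases hne : z = w
  -- at the pole, `green` has the value `0` by the convention `log 0 = 0`
  · rw [green_eq_neg_log, hne]
    simp only [diskMapInv, sub_self, mul_zero, zero_div, norm_zero, Real.log_zero, neg_zero]
    exact add_nonneg (Real.log_nonneg hK1) Real.posLog_nonneg
  have ht : 0 < ‖z - w‖ := norm_pos_iff.2 (sub_ne_zero.2 hne)
  have ht2 : ‖z - w‖ < 2 * R := by linarith [norm_sub_le z w]
  set t := ‖z - w‖ with ht_def
  refine (green_le_log hw hz hne).trans ?_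
  rw [← ht_def, Real.posLog_eq_log_max_one (by positivity), ← Real.log_mul (by positivity)
    (by positivity)]
  apply Real.log_le_log (by positivity)
  have hmono : R / t + t / (4 * R) ≤ r / t + t / (4 * r) := by
    have : r / t + t / (4 * r) - (R / t + t / (4 * R)) =
        (r - R) * (4 * r * R - t ^ 2) / (4 * r * R * t) := by
      field_simp
      ring
    have h2 : 0 ≤ (r - R) * (4 * r * R - t ^ 2) / (4 * r * R * t) := by
      apply div_nonneg (mul_nonneg (by linarith) ?_) (by positivity)
      nlinarith
    linarith
  refine hmono.trans ?_
  rcases le_total 1 (κ * t) with h | h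
  · refine le_trans ?_ (le_mul_of_one_le_right (by positivity) (le_max_left _ _))
    have : K - (r / t + t / (4 * r)) = (κ * t - 1) * (4 * r ^ 2 * κ - t) / (4 * r * κ * t) := by
      rw [hK]
      field_simp
      ring
    have h2 : 0 ≤ (κ * t - 1) * (4 * r ^ 2 * κ - t) / (4 * r * κ * t) := by
      apply div_nonneg (mul_nonneg (by linarith) ?_) (by positivity)
      nlinarith
    linarith
  · refine le_trans ?_ (mul_le_mul_of_nonneg_left (le_max_right _ _) (by positivity))
    have : K * (κ * t)⁻¹ - (r / t + t / (4 * r)) =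
        (1 - κ * t) * (1 + κ * t) / (4 * r * κ ^ 2 * t) := by
      rw [hK]
      field_simp
      ring
    have h2 : 0 ≤ (1 - κ * t) * (1 + κ * t) / (4 * r * κ ^ 2 * t) := by
      apply div_nonneg (mul_nonneg (by linarith) (by positivity)) (by positivity)
    linarith

/-- The Green potential of a density at a point of linear concentration. -/
theorem integral_green_mul_le {d : ℂ → ℝ} (hd : Continuous d) (hd0 : ∀ z, 0 ≤ d z) {R r κ n : ℝ}
    {w : ℂ} (hw : ‖w‖ < R) (hRr : R ≤ r) (hκ : 0 < κ) (hκr : 3 ≤ r * κ)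
    (hn : n = ∫ z in ball (0 : ℂ) r, d z)
    (hconc : ∀ t : ℝ, 0 < t →
      ((volume.restrict (ball (0 : ℂ) r)).withDensity fun z => ENNReal.ofReal (d z))
        (closedBall w t) ≤ ENNReal.ofReal (n * κ * t)) :
    ∫ z in ball (0 : ℂ) R, green R w z * d z ≤
      n * (Real.log (r * κ + 1 / (4 * (r * κ))) + 1) := by
  set L := Real.log (r * κ + 1 / (4 * (r * κ))) with hL
  have hL0 : 0 ≤ L := Real.log_nonneg (by
    have : 0 < 1 / (4 * (r * κ)) := by positivity
    linarith)
  have hn0 : 0 ≤ n := hn ▸ integral_nonneg hd0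
  have hdi : IntegrableOn d (ball (0 : ℂ) r) :=
    (hd.continuousOn.integrableOn_compact (isCompact_closedBall 0 r)).mono_set ball_subset_closedBall
  have hmeas : Measurable fun z : ℂ => log⁺ (κ * ‖z - w‖)⁻¹ :=
    Real.continuous_posLog.measurable.comp (by fun_prop)
  have hdm : Measurable fun z => ENNReal.ofReal (d z) := hd.measurable.ennreal_ofReal
  have hlint : ∫⁻ z in ball (0 : ℂ) r, ENNReal.ofReal (log⁺ (κ * ‖z - w‖)⁻¹ * d z) ≤
      ENNReal.ofReal n := by
    refine le_trans (le_of_eq ?_) (lintegral_posLog_le hn0 hκ hconc)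
    rw [lintegral_withDensity_eq_lintegral_mul _ hdm hmeas.ennreal_ofReal]
    refine lintegral_congr fun z => ?_
    rw [Pi.mul_apply, mul_comm, ENNReal.ofReal_mul (hd0 z)]
  have hpm : Measurable fun z : ℂ => log⁺ (κ * ‖z - w‖)⁻¹ * d z := hmeas.mul hd.measurable
  have hp0 : ∀ z : ℂ, 0 ≤ log⁺ (κ * ‖z - w‖)⁻¹ * d z := fun z =>
    mul_nonneg Real.posLog_nonneg (hd0 z)
  have hpi : IntegrableOn (fun z : ℂ => log⁺ (κ * ‖z - w‖)⁻¹ * d z) (ball (0 : ℂ) r) :=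
    ⟨hpm.aestronglyMeasurable, (hasFiniteIntegral_iff_ofReal (.of_forall hp0)).2
      (hlint.trans_lt ENNReal.ofReal_lt_top)⟩
  have hple : ∫ z in ball (0 : ℂ) r, log⁺ (κ * ‖z - w‖)⁻¹ * d z ≤ n := by
    rw [← ofReal_integral_eq_lintegral_ofReal hpi (.of_forall hp0)] at hlint
    exact (ENNReal.ofReal_le_ofReal_iff hn0).1 hlint
  have hsum : IntegrableOn (fun z : ℂ => L * d z + log⁺ (κ * ‖z - w‖)⁻¹ * d z) (ball (0 : ℂ) r) :=
    (hdi.const_mul L).add hpi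
  have hsub : ball (0 : ℂ) R ⊆ ball 0 r := ball_subset_ball hRr
  calc ∫ z in ball (0 : ℂ) R, green R w z * d z
      ≤ ∫ z in ball (0 : ℂ) R, (L * d z + log⁺ (κ * ‖z - w‖)⁻¹ * d z) := by
        refine integral_mono_of_nonneg ?_ (hsum.mono_set hsub) ?_
        · filter_upwards [ae_restrict_mem measurableSet_ball] with z hz
          exact mul_nonneg (green_nonneg hw (mem_ball_zero_iff.1 hz)) (hd0 z)
        · filter_upwards [ae_restrict_mem measurableSet_ball] with z hz
          rw [← add_mul]
          exact mul_le_mul_of_nonneg_right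
            (green_le_log_add_posLog hw (mem_ball_zero_iff.1 hz) hRr hκ hκr) (hd0 z)
    _ ≤ ∫ z in ball (0 : ℂ) r, (L * d z + log⁺ (κ * ‖z - w‖)⁻¹ * d z) :=
        setIntegral_mono_set hsum (.of_forall fun z => add_nonneg (mul_nonneg hL0 (hd0 z)) (hp0 z))
          hsub.eventuallyLE
    _ = L * n + ∫ z in ball (0 : ℂ) r, log⁺ (κ * ‖z - w‖)⁻¹ * d z := by
        rw [integral_add (hdi.const_mul L) hpi, integral_const_mul, hn]
    _ ≤ n * (L + 1) := by linarith

/-! ### The characteristic of a density -/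

section Characteristic

variable {d : ℂ → ℝ}

theorem integrableOn_ball (hd : Continuous d) (t : ℝ) : IntegrableOn d (ball (0 : ℂ) t) :=
  (hd.continuousOn.integrableOn_compact (isCompact_closedBall 0 t)).mono_set ball_subset_closedBall

theorem monotone_integral_ball (hd : Continuous d) (hd0 : ∀ z, 0 ≤ d z) :
    Monotone fun t : ℝ => ∫ z in ball (0 : ℂ) t, d z := fun _ t hst =>
  setIntegral_mono_set (integrableOn_ball hd t) (.of_forall hd0) (ball_subset_ball hst).eventuallyLE

theorem intervalIntegrable_characteristic (hd : Continuous d) (hd0 : ∀ z, 0 ≤ d z) {r : ℝ}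
    (hr : 0 ≤ r) :
    IntervalIntegrable (fun t : ℝ => (1 / t) * ∫ z in ball (0 : ℂ) t, d z) volume 0 r := by
  obtain ⟨C, hC⟩ := (isCompact_closedBall (0 : ℂ) r).bddAbove_image hd.continuousOn
  have hC0 : 0 ≤ C := (hd0 0).trans (hC ⟨0, by simpa using hr, rfl⟩)
  rw [intervalIntegrable_iff_integrableOn_Ioc_of_le hr]
  refine Measure.integrableOn_of_bounded (M := r * Real.pi * C) (by simp) ?_ ?_
  · exact ((measurable_const.div measurable_id).mul
      (monotone_integral_ball hd hd0).measurable).aestronglyMeasurable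
  · filter_upwards [ae_restrict_mem measurableSet_Ioc] with t ht
    have h1 : ∫ z in ball (0 : ℂ) t, d z ≤ C * (t ^ 2 * Real.pi) := by
      have h2 := setIntegral_mono_on (integrableOn_ball hd t)
        (integrableOn_const (C := C) (s := ball (0 : ℂ) t)) measurableSet_ball fun z hz =>
          hC ⟨z, ball_subset_closedBall (ball_subset_ball ht.2 hz), rfl⟩
      refine h2.trans (le_of_eq ?_)
      rw [setIntegral_const, measureReal_def, Complex.volume_ball]
      simp [ht.1.le, mul_comm]
    have h0 : 0 ≤ ∫ z in ball (0 : ℂ) t, d z := integral_nonneg hd0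
    have ht0 := ht.1
    rw [Real.norm_of_nonneg (by positivity)]
    calc (1 / t) * ∫ z in ball (0 : ℂ) t, d z ≤ (1 / t) * (C * (t ^ 2 * Real.pi)) := by gcongr
      _ = t * Real.pi * C := by field_simp
      _ ≤ _ := by have := ht.2; gcongr

theorem integral_ball_le_characteristic (hd : Continuous d) (hd0 : ∀ z, 0 ≤ d z) {r : ℝ}
    (hr : 0 < r) :
    ∫ z in ball (0 : ℂ) r, d z ≤
      ∫ t in (0 : ℝ)..(Real.exp 1 * r), (1 / t) * ∫ z in ball (0 : ℂ) t, d z := by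
  have hre : r ≤ Real.exp 1 * r := by nlinarith [Real.add_one_le_exp 1]
  have hi := intervalIntegrable_characteristic hd hd0 (hr.le.trans hre)
  have hi1 := intervalIntegrable_characteristic hd hd0 hr.le
  have hi2 := hi1.symm.trans hi
  rw [← intervalIntegral.integral_add_adjacent_intervals hi1 hi2]
  have hnn : ∀ t : ℝ, 0 ≤ ∫ z in ball (0 : ℂ) t, d z := fun t => integral_nonneg hd0
  have h1 : 0 ≤ ∫ t in (0 : ℝ)..r, (1 / t) * ∫ z in ball (0 : ℂ) t, d z :=
    intervalIntegral.integral_nonneg hr.le fun t ht => mul_nonneg (by have := ht.1; positivity) (hnn t)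
  have h2 : ∫ t in r..(Real.exp 1 * r), (1 / t) * ∫ z in ball (0 : ℂ) r, d z =
      ∫ z in ball (0 : ℂ) r, d z := by
    rw [intervalIntegral.integral_mul_const, integral_one_div_of_pos hr (by positivity),
      mul_div_assoc, div_self hr.ne', mul_one, Real.log_exp, one_mul]
  have h3 : ∫ t in r..(Real.exp 1 * r), (1 / t) * ∫ z in ball (0 : ℂ) r, d z ≤
      ∫ t in r..(Real.exp 1 * r), (1 / t) * ∫ z in ball (0 : ℂ) t, d z := by
    refine intervalIntegral.integral_mono_on hre ?_ hi2 fun t ht => ?_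
    · refine ContinuousOn.intervalIntegrable fun t ht => ?_
      rw [uIcc_of_le hre] at ht
      have : t ≠ 0 := (hr.trans_le ht.1).ne'
      exact ((continuousAt_const.div continuousAt_id this).mul
        continuousAt_const).continuousWithinAt
    · have := hr.trans_le ht.1
      exact mul_le_mul_of_nonneg_left (monotone_integral_ball hd hd0 ht.1) (by positivity)
  linarith

theorem characteristic_nonpos (hd : Continuous d) (hd0 : ∀ z, 0 ≤ d z) {r : ℝ}
    (hr : 0 < r) (hn : ∫ z in ball (0 : ℂ) r, d z ≤ 0) :
    ∫ t in (0 : ℝ)..r, (1 / t) * ∫ z in ball (0 : ℂ) t, d z ≤ 0 := by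
  rw [intervalIntegral.integral_of_le hr.le]
  refine setIntegral_nonpos measurableSet_Ioc fun t ht => ?_
  exact mul_nonpos_of_nonneg_of_nonpos (by have := ht.1; positivity)
    ((monotone_integral_ball hd hd0 ht.2).trans hn)

end Characteristic

end EntireCurve

/-! ### The Poisson–Jensen inequality for norms of sections -/

namespace EntireCurve

open Laplacian InnerProductSpace

/-- `κ` is a `C²` solution of `Δ κ = -2π d` near `z`. -/
def IsPotentialAt (d κ : ℂ → ℝ) (z : ℂ) : Prop :=
  ContDiffAt ℝ 2 κ z ∧ Δ κ =ᶠ[𝓝 z] fun ζ => -(2 * Real.pi) * d ζ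

theorem IsPotentialAt.sub_harmonicAt {d κ g : ℂ → ℝ} {z : ℂ} (hκ : IsPotentialAt d κ z)
    (hg : HarmonicAt g z) : IsPotentialAt d (κ - g) z := by
  refine ⟨hκ.1.sub hg.1, ?_⟩
  filter_upwards [hκ.1.laplacian_sub_nhds hg.1, hκ.2, hg.2] with ζ h1 h2 h3
  rw [h1, Pi.sub_apply, h2, h3, Pi.zero_apply, sub_zero]

theorem IsPotentialAt.add_harmonicAt {d κ g : ℂ → ℝ} {z : ℂ} (hκ : IsPotentialAt d κ z)
    (hg : HarmonicAt g z) : IsPotentialAt d (κ + g) z := by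
  simpa [sub_eq_add_neg] using hκ.sub_harmonicAt hg.neg

theorem harmonicAt_sum {ι : Type*} (s : Finset ι) {g : ι → ℂ → ℝ} {z : ℂ}
    (hg : ∀ i ∈ s, HarmonicAt (g i) z) : HarmonicAt (∑ i ∈ s, g i) z := by
  classical
  induction s using Finset.induction_on with
  | empty => exact harmonicAt_const 0
  | insert a s ha ih =>
    rw [Finset.sum_insert ha]
    exact (hg a (by simp)).add (ih fun i hi => hg i (by simp [hi]))

/-- The functions that look locally like the pointwise norm `z ↦ ‖φ^* s‖(z)` of a section: `N` is
`|h| e^g` for a holomorphic `h` with `m z = ord_z h`, and `Δ g = -2π d`. -/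
def IsSectionNorm (N : ℂ → ℝ) (m : ℂ → ℕ) (d : ℂ → ℝ) : Prop :=
  ∀ z, ∃ (h : ℂ → ℂ) (g : ℂ → ℝ), AnalyticAt ℂ h z ∧ IsPotentialAt d g z ∧
    (∀ᶠ ζ in 𝓝 z, N ζ = ‖h ζ‖ * Real.exp (g ζ)) ∧ m z = analyticOrderNatAt h z

/-- Removing isolated singularities: the punctured limits of `V₀` agree near `z` with every `C²`
function that agrees with `V₀` on a punctured neighbourhood of `z`. -/
theorem exists_contDiff_extension (V₀ : ℂ → ℝ) :
    ∃ V : ℂ → ℝ, (∀ z, ContinuousAt V₀ z → V z = V₀ z) ∧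
      ∀ z (κ : ℂ → ℝ), ContDiffAt ℝ 2 κ z → V₀ =ᶠ[𝓝[≠] z] κ → V =ᶠ[𝓝 z] κ := by
  refine ⟨fun z => limUnder (𝓝[≠] z) V₀, fun z hz => ?_, fun z κ hκ h => ?_⟩
  · exact (hz.mono_left nhdsWithin_le_nhds : Tendsto V₀ (𝓝[≠] z) (𝓝 (V₀ z))).limUnder_eq
  · rw [EventuallyEq, eventually_nhdsWithin_iff] at h
    filter_upwards [h.eventually_nhds, hκ.eventually (by simp)] with ζ h1 h2
    have h3 : V₀ =ᶠ[𝓝[≠] ζ] κ := by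
      by_cases hζ : ζ = z
      · subst hζ
        exact eventually_nhdsWithin_iff.2 h1
      · have h4 : ∀ᶠ x in 𝓝 ζ, x ≠ z := isOpen_ne.mem_nhds hζ
        refine EventuallyEq.filter_mono ?_ nhdsWithin_le_nhds
        filter_upwards [h1, h4] with x hx hx'
        exact hx hx'
    exact (Tendsto.congr' h3.symm
      (h2.continuousAt.mono_left nhdsWithin_le_nhds : Tendsto κ (𝓝[≠] ζ) (𝓝 (κ ζ)))).limUnder_eq

theorem green_symm (R : ℝ) (w z : ℂ) : green R w z = green R z w := by
  rw [green, green, norm_div, norm_div, norm_mul, norm_mul, norm_sub_rev z w]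
  congr 2
  rw [← norm_star]
  simp [mul_comm]

namespace IsSectionNorm

variable {N : ℂ → ℝ} {m : ℂ → ℕ} {d : ℂ → ℝ}

theorem continuous (H : IsSectionNorm N m d) : Continuous N := by
  refine continuous_iff_continuousAt.2 fun z => ?_
  obtain ⟨h, g, hh, hg, hN, -⟩ := H z
  have h1 := hh.continuousAt
  have h2 := hg.1.continuousAt
  exact ContinuousAt.congr (by fun_prop) (EventuallyEq.symm hN)

theorem nonneg (H : IsSectionNorm N m d) (z : ℂ) : 0 ≤ N z := by
  obtain ⟨h, g, hh, hg, hN, -⟩ := H z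
  rw [hN.self_of_nhds]
  positivity

theorem eventually_zero_or (H : IsSectionNorm N m d) (z : ℂ) :
    (∀ᶠ ζ in 𝓝 z, N ζ = 0) ∨ ∀ᶠ ζ in 𝓝[≠] z, N ζ ≠ 0 := by
  obtain ⟨h, g, hh, hg, hN, -⟩ := H z
  refine hh.eventually_eq_zero_or_eventually_ne_zero.imp (fun h0 => ?_) fun h0 => ?_
  · filter_upwards [hN, h0] with ζ h1 h2
    simp [h1, h2]
  · filter_upwards [hN.filter_mono nhdsWithin_le_nhds, h0] with ζ h1 h2
    simp [h1, h2]

/-- The identity theorem. -/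
theorem eventually_ne_zero (H : IsSectionNorm N m d) {w : ℂ} (hw : N w ≠ 0) (z : ℂ) :
    ∀ᶠ ζ in 𝓝[≠] z, N ζ ≠ 0 := by
  set A : Set ℂ := {z | ∀ᶠ ζ in 𝓝 z, N ζ = 0} with hA
  have hopen : IsOpen A := isOpen_iff_mem_nhds.2 fun z hz => Eventually.eventually_nhds hz
  have hclosed : IsClosed A := by
    refine ⟨isOpen_iff_mem_nhds.2 fun z hz => ?_⟩
    have h1 := (H.eventually_zero_or z).resolve_left hz
    rw [eventually_nhdsWithin_iff] at h1
    filter_upwards [h1] with ζ h2 (h3 : ∀ᶠ x in 𝓝 ζ, N x = 0)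
    by_cases hζ : ζ = z
    · exact hz (hζ ▸ h3)
    · exact h2 hζ h3.self_of_nhds
  rcases isClopen_iff.1 ⟨hclosed, hopen⟩ with h | h
  · exact (H.eventually_zero_or z).resolve_left fun hz => by
      have : z ∈ A := hz
      rw [h] at this
      exact this
  · have : w ∈ A := h ▸ mem_univ w
    exact absurd (Eventually.self_of_nhds this) hw

theorem local_form (H : IsSectionNorm N m d) {w : ℂ} (hw : N w ≠ 0) (z : ℂ) :
    (m z ≠ 0 ↔ N z = 0) ∧ ∃ κ : ℂ → ℝ, IsPotentialAt d κ z ∧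
      ∀ᶠ ζ in 𝓝[≠] z, Real.log (N ζ) = m z * Real.log ‖ζ - z‖ + κ ζ := by
  have hne := H.eventually_ne_zero hw z
  obtain ⟨h, g, hh, hg, hN, hm⟩ := H z
  have htop : analyticOrderAt h z ≠ ⊤ := by
    intro htop
    rw [analyticOrderAt_eq_top] at htop
    have h1 : ∀ᶠ ζ in 𝓝[≠] z, N ζ = 0 := by
      filter_upwards [hN.filter_mono nhdsWithin_le_nhds, htop.filter_mono nhdsWithin_le_nhds]
        with ζ h1 h2
      simp [h1, h2]
    obtain ⟨ζ, h2, h3⟩ := (hne.and h1).exists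
    exact h2 h3
  constructor
  · rw [hm, hN.self_of_nhds]
    have : analyticOrderNatAt h z ≠ 0 ↔ analyticOrderAt h z ≠ 0 := by
      rw [← Nat.cast_analyticOrderNatAt htop]
      simp
    rw [this, hh.analyticOrderAt_ne_zero]
    simp
  · obtain ⟨k, hk, hk0, hhk⟩ := hh.analyticOrderAt_ne_top.1 htop
    rw [← hm] at hhk
    refine ⟨g + fun ζ => Real.log ‖k ζ‖, hg.add_harmonicAt (hk.harmonicAt_log_norm hk0), ?_⟩
    have hk0' : ∀ᶠ ζ in 𝓝 z, k ζ ≠ 0 := hk.continuousAt.eventually_ne hk0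
    filter_upwards [hN.filter_mono nhdsWithin_le_nhds, hhk.filter_mono nhdsWithin_le_nhds,
      hk0'.filter_mono nhdsWithin_le_nhds, self_mem_nhdsWithin] with ζ h1 h2 h3 h4
    have h5 : ‖ζ - z‖ ≠ 0 := norm_ne_zero_iff.2 (sub_ne_zero.2 h4)
    have h6 := norm_ne_zero_iff.2 h3
    rw [h1, h2, norm_smul, norm_pow, Real.log_mul (by positivity) (by positivity),
      Real.log_mul (by positivity) h6, Real.log_pow, Real.log_exp]
    simp only [Pi.add_apply]
    ring

theorem finite_zeros (H : IsSectionNorm N m d) {w : ℂ} (hw : N w ≠ 0) (r : ℝ) :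
    {z ∈ ball (0 : ℂ) r | m z ≠ 0}.Finite := by
  have hU : ∀ z ∈ closedBall (0 : ℂ) r, {ζ | ζ ≠ z → N ζ ≠ 0} ∈ 𝓝 z := fun z _ =>
    eventually_nhdsWithin_iff.1 (H.eventually_ne_zero hw z)
  obtain ⟨t, -, ht⟩ := (isCompact_closedBall (0 : ℂ) r).elim_nhds_subcover _ hU
  refine t.finite_toSet.subset fun z hz => ?_
  obtain ⟨x, hx, hzx⟩ := mem_iUnion₂.1 (ht (ball_subset_closedBall hz.1))
  by_cases h : z = x
  · exact h ▸ hx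
  · exact absurd ((H.local_form hw z).1.1 hz.2) (hzx h)

theorem log_le_log_sSup (H : IsSectionNorm N m d) {z : ℂ} {r : ℝ} (hz : z ∈ closedBall (0 : ℂ) r)
    (h0 : N z ≠ 0) : Real.log (N z) ≤ Real.log (sSup (N '' closedBall (0 : ℂ) r)) :=
  Real.log_le_log ((H.nonneg z).lt_of_ne' h0) (le_csSup
    ((isCompact_closedBall (0 : ℂ) r).bddAbove_image H.continuous.continuousOn) ⟨z, hz, rfl⟩)

/-- The Poisson–Jensen inequality on a disk without zeros on its boundary. After division by the
Blaschke product of the zeros, `log N` becomes a `C²` function. -/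
theorem sum_green_add_log_le_of_lt (H : IsSectionNorm N m d) {R r : ℝ} (hRr : R < r) {w : ℂ}
    (hwR : ‖w‖ < R) (hw : N w ≠ 0) (P : Finset ℂ)
    (hP : ∀ z, z ∈ P ↔ z ∈ ball (0 : ℂ) r ∧ m z ≠ 0) (hPR : ∀ p ∈ P, ‖p‖ < R) :
    ∑ p ∈ P, (m p : ℝ) * green R w p + Real.log (N w) ≤
      Real.log (sSup (N '' closedBall (0 : ℂ) r)) + ∫ z in ball (0 : ℂ) R, green R w z * d z := by
  have hR : 0 < R := (norm_nonneg w).trans_lt hwR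
  have hsub : ∀ {z : ℂ}, ‖z‖ ≤ R → z ∈ ball (0 : ℂ) r := fun h =>
    mem_ball_zero_iff.2 (h.trans_lt hRr)
  -- the Blaschke factor of `p` is `(ζ - p) * b p ζ`, where `b p` has no zeros in the disk
  set b : ℂ → ℂ → ℂ := fun p ζ => R / ((R : ℂ) ^ 2 - ζ * star p) with hb
  set V₀ : ℂ → ℝ := fun ζ => Real.log (N ζ) - ∑ p ∈ P, (m p : ℝ) * Real.log ‖diskMapInv R p ζ‖
    with hV₀
  obtain ⟨V, hVc, hVκ⟩ := exists_contDiff_extension V₀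
  have hlocal : ∀ z : ℂ, ‖z‖ ≤ R → ∃ κ : ℂ → ℝ, IsPotentialAt d κ z ∧ V =ᶠ[𝓝 z] κ := by
    intro z hz
    obtain ⟨-, κ, hκ, hlog⟩ := H.local_form hw z
    have hh1 : HarmonicAt (∑ p ∈ P, (m p : ℝ) • fun ζ => Real.log ‖b p ζ‖) z := by
      refine harmonicAt_sum _ fun p hp => HarmonicAt.const_smul (AnalyticAt.harmonicAt_log_norm
        ?_ ?_)
      · exact AnalyticAt.div (by fun_prop) (by fun_prop) (diskMapInv_denom_ne_zero (hPR p hp) hz)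
      · exact div_ne_zero (by exact_mod_cast hR.ne') (diskMapInv_denom_ne_zero (hPR p hp) hz)
    have hh2 : HarmonicAt (∑ p ∈ P.erase z, (m p : ℝ) • fun ζ : ℂ => Real.log ‖ζ - p‖) z := by
      refine harmonicAt_sum _ fun p hp => HarmonicAt.const_smul (AnalyticAt.harmonicAt_log_norm
        (by fun_prop) (sub_ne_zero.2 (Finset.ne_of_mem_erase hp).symm))
    refine ⟨_, (hκ.sub_harmonicAt hh2).sub_harmonicAt hh1, hVκ z _
      ((hκ.sub_harmonicAt hh2).sub_harmonicAt hh1).1 ?_⟩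
    have hden : ∀ p ∈ P, ∀ᶠ ζ in 𝓝[≠] z, Real.log ‖diskMapInv R p ζ‖ =
        Real.log ‖ζ - p‖ + Real.log ‖b p ζ‖ := by
      intro p hp
      have hne : ∀ᶠ ζ in 𝓝[≠] z, ζ ≠ p := by
        by_cases hpz : p = z
        · exact hpz ▸ self_mem_nhdsWithin
        · exact nhdsWithin_le_nhds (isOpen_ne.mem_nhds (Ne.symm hpz))
      have hcont : ContinuousAt (fun ζ : ℂ => (R : ℂ) ^ 2 - ζ * star p) z := by fun_prop
      filter_upwards [hne, (hcont.eventually_ne (diskMapInv_denom_ne_zero (hPR p hp) hz)).filter_mono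
        nhdsWithin_le_nhds] with ζ h1 h2
      have h3 : diskMapInv R p ζ = (ζ - p) * b p ζ := by
        simp only [diskMapInv, hb]
        ring
      rw [h3, norm_mul, Real.log_mul (norm_ne_zero_iff.2 (sub_ne_zero.2 h1))
        (norm_ne_zero_iff.2 (div_ne_zero (by exact_mod_cast hR.ne') h2))]
    filter_upwards [hlog, (Filter.eventually_all_finset P).2 hden] with ζ h1 h2
    -- the singularity of `log N` at `z` cancels against the factor of `z`, which is trivial if
    -- `z` is not a zero
    have h3 : ∑ p ∈ P, (m p : ℝ) * Real.log ‖ζ - p‖ =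
        ∑ p ∈ P.erase z, (m p : ℝ) * Real.log ‖ζ - p‖ + m z * Real.log ‖ζ - z‖ := by
      by_cases hzP : z ∈ P
      · rw [Finset.sum_erase_add _ _ hzP]
      · have : m z = 0 := by
          by_contra h
          exact hzP ((hP z).2 ⟨hsub hz, h⟩)
        rw [Finset.erase_eq_of_notMem hzP, this]
        simp
    have h4 : ∑ p ∈ P, (m p : ℝ) * Real.log ‖diskMapInv R p ζ‖ =
        ∑ p ∈ P, (m p : ℝ) * Real.log ‖ζ - p‖ + ∑ p ∈ P, (m p : ℝ) * Real.log ‖b p ζ‖ := by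
      rw [← Finset.sum_add_distrib]
      exact Finset.sum_congr rfl fun p hp => by rw [h2 p hp]; ring
    simp only [hV₀, Pi.sub_apply, Finset.sum_apply, Pi.smul_apply, smul_eq_mul]
    rw [h1, h4, h3]
    ring
  have hcont : ∀ z : ℂ, ‖z‖ ≤ R → N z ≠ 0 → ContinuousAt V₀ z := by
    intro z hz hNz
    refine ContinuousAt.sub (H.continuous.continuousAt.log hNz) ?_
    refine tendsto_finsetSum _ fun p hp => ContinuousAt.mul continuousAt_const ?_
    have h1 : z ≠ p := by
      rintro rfl
      exact hNz ((H.local_form hw z).1.1 ((hP z).1 hp).2)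
    exact (analyticAt_diskMapInv (hPR p hp) hz).continuousAt.norm.log
      (norm_ne_zero_iff.2 fun h => h1 ((diskMapInv_eq_zero_iff (hPR p hp) hz).1 h))
  have hmain := le_add_integral_green (V := V) (d := d)
    (C := Real.log (sSup (N '' closedBall (0 : ℂ) r))) hwR
    (fun z hz => by
      obtain ⟨κ, hκ, hV⟩ := hlocal z (mem_closedBall_zero_iff.1 hz)
      exact hκ.1.congr_of_eventuallyEq hV)
    (fun z hz => by
      rw [mem_sphere_zero_iff_norm] at hz
      have hNz : N z ≠ 0 := fun h0 =>
        (hPR z ((hP z).2 ⟨hsub hz.le, (H.local_form hw z).1.2 h0⟩)).ne hz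
      rw [hVc z (hcont z hz.le hNz)]
      have h1 : ∑ p ∈ P, (m p : ℝ) * Real.log ‖diskMapInv R p z‖ = 0 :=
        Finset.sum_eq_zero fun p hp => by
          rw [norm_diskMapInv_of_norm_eq (hPR p hp) hz, Real.log_one, mul_zero]
      simp only [hV₀]
      rw [h1, sub_zero]
      exact H.log_le_log_sSup (ball_subset_closedBall (hsub hz.le)) hNz)
    (fun z hz => by
      obtain ⟨κ, hκ, hV⟩ := hlocal z (mem_ball_zero_iff.1 hz).le
      rw [(laplacian_congr_nhds hV).eq_of_nhds, hκ.2.eq_of_nhds])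
  rw [hVc w (hcont w hwR.le hw)] at hmain
  have h1 : ∑ p ∈ P, (m p : ℝ) * green R w p =
      -∑ p ∈ P, (m p : ℝ) * Real.log ‖diskMapInv R p w‖ := by
    rw [← Finset.sum_neg_distrib]
    exact Finset.sum_congr rfl fun p _ => by rw [green_symm, green_eq_neg_log]; ring
  rw [h1]
  simp only [hV₀] at hmain
  linarith

/-- The Poisson–Jensen inequality, with any bound `B` for the Green potentials of `d`. Zeros on the
circle `|z| = r` are avoided by letting smaller radii tend to `r`. -/
theorem finsum_green_add_log_le (H : IsSectionNorm N m d) {r B : ℝ} {w : ℂ} (hwr : ‖w‖ < r)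
    (hw : N w ≠ 0)
    (hB : ∀ R, ‖w‖ < R → R ≤ r → ∫ z in ball (0 : ℂ) R, green R w z * d z ≤ B) :
    ∑ᶠ z ∈ ball (0 : ℂ) r, (m z : ℝ) * green r w z + Real.log (N w) ≤
      Real.log (sSup (N '' closedBall (0 : ℂ) r)) + B := by
  set P := (H.finite_zeros hw r).toFinset with hPdef
  have hP : ∀ z, z ∈ P ↔ z ∈ ball (0 : ℂ) r ∧ m z ≠ 0 := fun z => by simp [hPdef]
  have hsum : ∑ᶠ z ∈ ball (0 : ℂ) r, (m z : ℝ) * green r w z =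
      ∑ p ∈ P, (m p : ℝ) * green r w p := by
    refine finsum_mem_eq_sum_of_inter_support_eq _ ?_
    ext z
    simp only [mem_inter_iff, Function.mem_support, Finset.mem_coe, hP]
    constructor
    · rintro ⟨h1, h2⟩
      exact ⟨⟨h1, fun h => h2 (by simp [h])⟩, h2⟩
    · rintro ⟨⟨h1, -⟩, h2⟩
      exact ⟨h1, h2⟩
  rw [hsum]
  have hr : 0 < r := (norm_nonneg w).trans_lt hwr
  have hlim : Tendsto (fun R : ℝ => ∑ p ∈ P, (m p : ℝ) * green R w p + Real.log (N w)) (𝓝[<] r)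
      (𝓝 (∑ p ∈ P, (m p : ℝ) * green r w p + Real.log (N w))) := by
    refine Tendsto.add_const _ (tendsto_finsetSum _ fun p hp => Tendsto.const_mul _ ?_)
    have hpr := mem_ball_zero_iff.1 ((hP p).1 hp).1
    have hpw : p ≠ w := by
      rintro rfl
      exact hw ((H.local_form hw p).1.1 ((hP p).1 hp).2)
    have h1 : ContinuousAt (fun R : ℝ => ‖((R : ℂ) ^ 2 - p * star w) / ((R : ℂ) * (p - w))‖) r := by
      refine ContinuousAt.norm (ContinuousAt.div (by fun_prop) (by fun_prop) ?_)
      exact mul_ne_zero (by exact_mod_cast hr.ne') (sub_ne_zero.2 hpw)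
    have h2 : ‖((r : ℂ) ^ 2 - p * star w) / ((r : ℂ) * (p - w))‖ ≠ 0 :=
      norm_ne_zero_iff.2 (div_ne_zero (diskMapInv_denom_ne_zero hwr hpr.le)
        (mul_ne_zero (by exact_mod_cast hr.ne') (sub_ne_zero.2 hpw)))
    exact (h1.log h2).mono_left nhdsWithin_le_nhds
  refine le_of_tendsto hlim ?_
  have hPev : ∀ᶠ R in 𝓝[<] r, ∀ p ∈ P, ‖p‖ < R :=
    (Filter.eventually_all_finset P).2 fun p hp =>
      nhdsWithin_le_nhds (isOpen_Ioi.mem_nhds (mem_ball_zero_iff.1 ((hP p).1 hp).1))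
  filter_upwards [hPev, self_mem_nhdsWithin, nhdsWithin_le_nhds (isOpen_Ioi.mem_nhds hwr)]
    with R h1 h2 h3
  have := H.sum_green_add_log_le_of_lt h2 h3 hw P hP h1
  linarith [hB R h3 (le_of_lt h2)]

end IsSectionNorm

end EntireCurve

/-! ### Holomorphic lifts, the curvature density and sections -/

namespace EntireCurve

open Laplacian InnerProductSpace

variable {N : ℕ} {X : Set (PSpace N)} {φ : ℂ → PSpace N}

theorem exists_rep_eq_smul {p : PSpace N} {v : Coord N} (hv : v ≠ 0)
    (hp : p = Projectivization.mk ℂ v hv) : ∃ a : ℂ, a ≠ 0 ∧ p.rep = a • v := by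
  obtain ⟨a, ha⟩ := Projectivization.exists_smul_eq_mk_rep ℂ v hv
  exact ⟨a, a.ne_zero, by rw [hp, ← ha]; rfl⟩

/-- `localLift φ z` is a multiple of any other lift. -/
theorem localLift_eq_smul {z ζ : ℂ} {v : Coord N} (hv : v ≠ 0)
    (hφ : φ ζ = Projectivization.mk ℂ v hv) :
    localLift φ z ζ = (star (φ z).rep ⬝ᵥ v)⁻¹ • v := by
  obtain ⟨a, ha, h⟩ := exists_rep_eq_smul hv hφ
  rw [localLift, h, dotProduct_smul, smul_eq_mul, mul_inv, smul_smul, mul_right_comm,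
    inv_mul_cancel₀ ha, one_mul]

/-- A holomorphic lift of `φ` to nonzero coordinate vectors, near `z`. -/
def IsLiftAt (φ : ℂ → PSpace N) (f : ℂ → Coord N) (z : ℂ) : Prop :=
  AnalyticAt ℂ f z ∧ ∀ᶠ ζ in 𝓝 z, ∃ h : f ζ ≠ 0, φ ζ = Projectivization.mk ℂ (f ζ) h

theorem IsLiftAt.eventually {f : ℂ → Coord N} {z : ℂ} (hf : IsLiftAt φ f z) :
    ∀ᶠ ζ in 𝓝 z, IsLiftAt φ f ζ := by
  filter_upwards [hf.1.eventually_analyticAt, hf.2.eventually_nhds] with ζ h1 h2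
  exact ⟨h1, h2⟩

theorem analyticAt_dotProduct {f : ℂ → Coord N} {z : ℂ} (hf : AnalyticAt ℂ f z) (v : Coord N) :
    AnalyticAt ℂ (fun ζ => v ⬝ᵥ f ζ) z := by
  have : ∀ i, AnalyticAt ℂ (fun ζ => f ζ i) z := fun i =>
    ((ContinuousLinearMap.proj (R := ℂ) (φ := fun _ : Fin (N + 1) => ℂ) i).analyticAt _).comp hf
  simp only [dotProduct]
  exact Finset.analyticAt_fun_sum _ fun i _ => analyticAt_const.mul (this i)

open scoped ComplexOrder in
theorem star_rep_dotProduct_ne_zero {z : ℂ} {v : Coord N} (hv : v ≠ 0)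
    (hφ : φ z = Projectivization.mk ℂ v hv) : star (φ z).rep ⬝ᵥ v ≠ 0 := by
  obtain ⟨a, ha, h⟩ := exists_rep_eq_smul hv hφ
  intro h0
  have : star (φ z).rep ⬝ᵥ (φ z).rep = 0 := by
    nth_rewrite 2 [h]
    rw [dotProduct_smul, h0, smul_zero]
  exact (φ z).rep_nonzero (dotProduct_star_self_eq_zero.1 this)

/-- Near `z`, the normalized lift is `a f` with a holomorphic function `a` without zeros. -/
theorem IsLiftAt.localLift_eventuallyEq {f : ℂ → Coord N} {z : ℂ} (hf : IsLiftAt φ f z) :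
    ∃ a : ℂ → ℂ, AnalyticAt ℂ a z ∧ a z ≠ 0 ∧
      localLift φ z =ᶠ[𝓝 z] fun ζ => a ζ • f ζ := by
  obtain ⟨h0, hφ0⟩ := hf.2.self_of_nhds
  have h1 := star_rep_dotProduct_ne_zero h0 hφ0
  refine ⟨fun ζ => (star (φ z).rep ⬝ᵥ f ζ)⁻¹, (analyticAt_dotProduct hf.1 _).inv h1,
    inv_ne_zero h1, ?_⟩
  filter_upwards [hf.2] with ζ ⟨h, hφ⟩
  exact localLift_eq_smul h hφ

theorem IsHolomorphic.isLiftAt_localLift (hφ : IsHolomorphic φ) (z : ℂ) :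
    IsLiftAt φ (localLift φ z) z := by
  obtain ⟨f, hf⟩ := hφ z
  have hf : IsLiftAt φ f z := hf
  obtain ⟨a, ha, ha0, h⟩ := hf.localLift_eventuallyEq
  refine ⟨(ha.smul hf.1).congr h.symm, ?_⟩
  filter_upwards [hf.2, h, ha.continuousAt.eventually_ne ha0] with ζ ⟨h1, h2⟩ h3 h4
  have h5 : localLift φ z ζ ≠ 0 := by
    rw [h3]
    exact smul_ne_zero h4 h1
  refine ⟨h5, ?_⟩
  rw [h2, Projectivization.mk_eq_mk_iff']
  refine ⟨(a ζ)⁻¹, ?_⟩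
  rw [h3, smul_smul, inv_mul_cancel₀ h4, one_smul]

theorem IsLiftAt.mem_cone {f : ℂ → Coord N} {z : ℂ} (hf : IsLiftAt φ f z) (hX : ∀ z, φ z ∈ X) :
    ∀ᶠ ζ in 𝓝 z, f ζ ∈ cone X := by
  filter_upwards [hf.2] with ζ ⟨h, h'⟩
  exact ⟨h, h' ▸ hX ζ⟩

/-! #### The weight and its curvature -/

section Weight

variable (M : PositiveMetric X)

theorem contDiffAt_log_weight {v : Coord N} (hv : v ≠ 0) :
    ContDiffAt ℝ 2 (fun w => Real.log (M.weight w)) v :=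
  ((contDiffOn_infty.1 M.smooth 2).contDiffAt (isOpen_ne.mem_nhds hv)).log
    (M.weight_pos v hv).ne'

theorem log_weight_smul {a : ℂ} {v : Coord N} (ha : a ≠ 0) (hv : v ≠ 0) :
    Real.log (M.weight (a • v)) = 2 * Real.log ‖a‖ + Real.log (M.weight v) := by
  have := norm_ne_zero_iff.2 ha
  rw [M.weight_smul a v ha hv, Real.log_mul (by positivity) (M.weight_pos v hv).ne', Real.log_pow]
  norm_num

variable {M}

theorem IsLiftAt.contDiffAt_log_weight {f : ℂ → Coord N} {z : ℂ} (hf : IsLiftAt φ f z) :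
    ContDiffAt ℝ 2 (fun ζ => Real.log (M.weight (f ζ))) z :=
  (EntireCurve.contDiffAt_log_weight M hf.2.self_of_nhds.1).comp z
    (hf.1.contDiffAt.restrict_scalars ℝ)

/-- Multiplying a map by a holomorphic function without zeros does not change
`∂∂̄ log weight`. -/
theorem laplacian_log_weight_smul {f : ℂ → Coord N} {a : ℂ → ℂ} {z : ℂ} (ha : AnalyticAt ℂ a z)
    (ha0 : a z ≠ 0) (hf : AnalyticAt ℂ f z) (hf0 : f z ≠ 0) :
    Δ (fun ζ => Real.log (M.weight (a ζ • f ζ))) z = Δ (fun ζ => Real.log (M.weight (f ζ))) z := by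
  have hh : HarmonicAt ((2 : ℝ) • fun ζ => Real.log ‖a ζ‖) z :=
    (ha.harmonicAt_log_norm ha0).const_smul
  have hu : ContDiffAt ℝ 2 (fun ζ => Real.log (M.weight (f ζ))) z :=
    (EntireCurve.contDiffAt_log_weight M hf0).comp z (hf.contDiffAt.restrict_scalars ℝ)
  have h1 : (fun ζ => Real.log (M.weight (a ζ • f ζ))) =ᶠ[𝓝 z]
      ((2 : ℝ) • fun ζ => Real.log ‖a ζ‖) + fun ζ => Real.log (M.weight (f ζ)) := by
    filter_upwards [ha.continuousAt.eventually_ne ha0, hf.continuousAt.eventually_ne hf0]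
      with ζ h2 h3
    simp [log_weight_smul M h2 h3]
  rw [(laplacian_congr_nhds h1).eq_of_nhds, hh.1.laplacian_add hu, hh.2.eq_of_nhds,
    Pi.zero_apply, zero_add]

theorem IsLiftAt.chernDensity_eq (hφ : IsHolomorphic φ) {f : ℂ → Coord N} {z : ℂ}
    (hf : IsLiftAt φ f z) :
    chernDensity M φ z = 1 / (4 * Real.pi) * Δ (fun ζ => Real.log (M.weight (f ζ))) z := by
  have hl := hφ.isLiftAt_localLift z
  obtain ⟨a, ha, ha0, h⟩ := hf.localLift_eventuallyEq
  have h1 := laplacian_comp_eq_leviForm (F := localLift φ z)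
    (EntireCurve.contDiffAt_log_weight M hl.2.self_of_nhds.1) hl.1
  have h2 : (fun ζ => Real.log (M.weight (localLift φ z ζ))) =ᶠ[𝓝 z]
      fun ζ => Real.log (M.weight (a ζ • f ζ)) := by
    filter_upwards [h] with ζ hζ
    rw [hζ]
  rw [(laplacian_congr_nhds h2).eq_of_nhds,
    laplacian_log_weight_smul ha ha0 hf.1 hf.2.self_of_nhds.1] at h1
  rw [chernDensity, h1]
  field_simp

variable (M)

theorem continuous_chernDensity (hφ : IsHolomorphic φ) : Continuous (chernDensity M φ) := by
  refine continuous_iff_continuousAt.2 fun z => ?_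
  have hl := hφ.isLiftAt_localLift z
  have h1 : chernDensity M φ =ᶠ[𝓝 z] fun ζ =>
      1 / (4 * Real.pi) * Δ (fun ζ => Real.log (M.weight (localLift φ z ζ))) ζ := by
    filter_upwards [hl.eventually] with ζ hζ
    exact hζ.chernDensity_eq hφ
  refine ContinuousAt.congr ?_ h1.symm
  have h2 : ContDiffAt ℝ 2 (fun ζ => Real.log (M.weight (localLift φ z ζ))) z :=
    hl.contDiffAt_log_weight
  have h3 := ((h2.fderiv_right (m := 1) (by norm_num)).fderiv_right (m := 0)
    (by norm_num)).continuousAt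
  simp only [laplacian_eq_fderiv_fderiv]
  fun_prop

theorem hasDerivAt_eval_mvPolynomial (F : MvPolynomial (Fin (N + 1)) ℂ) {f : ℂ → Coord N}
    {f' : Coord N} {z : ℂ} (hf : HasDerivAt f f' z) :
    HasDerivAt (fun ζ => MvPolynomial.eval (f ζ) F)
      (∑ i, MvPolynomial.eval (f z) (MvPolynomial.pderiv i F) * f' i) z := by
  induction F using MvPolynomial.induction_on with
  | C a => simpa using hasDerivAt_const z a
  | add p q hp hq =>
    simp only [map_add, add_mul, Finset.sum_add_distrib]
    exact hp.add hq
  | mul_X p j hp =>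
    have h1 := hp.mul (hasDerivAt_pi.1 hf j)
    simp only [map_mul, MvPolynomial.eval_X]
    refine h1.congr_deriv ?_
    simp only [Derivation.leibniz, MvPolynomial.pderiv_X, smul_eq_mul, map_add, map_mul,
      MvPolynomial.eval_X, add_mul, Finset.sum_add_distrib, Finset.sum_mul]
    rw [add_comm]
    congr 1
    · rw [Finset.sum_eq_single j]
      · simp
      · intro i _ hij
        simp [Pi.single_eq_of_ne hij.symm]
      · simp
    · exact Finset.sum_congr rfl fun i _ => by ring

theorem leviForm_log_weight_radial {v : Coord N} (hv : v ≠ 0) (a : ℂ) :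
    leviForm (fun w => Real.log (M.weight w)) v (a • v) = 0 := by
  have h1 : (fun t : ℂ => Real.log (M.weight (v + t • a • v))) =
      fun t : ℂ => Real.log (M.weight ((1 + t * a) • (fun _ : ℂ => v) t)) := by
    ext t
    rw [add_smul, one_smul, smul_smul]
  rw [leviForm, h1, laplacian_log_weight_smul (by fun_prop) (by simp) analyticAt_const hv]
  simp

theorem chernDensity_nonneg (hφ : IsHolomorphic φ) (hX : ∀ z, φ z ∈ X) (z : ℂ) :
    0 ≤ chernDensity M φ z := by
  have hl := hφ.isLiftAt_localLift z
  have hcone := hl.mem_cone hX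
  refine mul_nonneg (by positivity) ?_
  -- the metric is positive in nonradial directions only; radially, the Levi form vanishes
  by_cases hrad : ∃ a : ℂ, deriv (localLift φ z) z = a • localLift φ z z
  · obtain ⟨a, ha⟩ := hrad
    rw [ha, leviForm_log_weight_radial M hl.2.self_of_nhds.1]
  · refine (M.positive _ hcone.self_of_nhds _ (fun F hF => ?_) hrad).le
    have h1 := hasDerivAt_eval_mvPolynomial F hl.1.differentiableAt.hasDerivAt
    have h2 : (fun ζ => MvPolynomial.eval (localLift φ z ζ) F) =ᶠ[𝓝 z] fun _ => 0 := by
      filter_upwards [hcone] with ζ hζ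
      exact hF _ hζ
    exact h1.unique ((hasDerivAt_const z (0 : ℂ)).congr_of_eventuallyEq h2)

/-! #### Sections along the curve -/

theorem GlobalSection.analyticAt_comp_lift (s : GlobalSection X) (hX : ∀ z, φ z ∈ X)
    {f : ℂ → Coord N} {z : ℂ} (hf : IsLiftAt φ f z) : AnalyticAt ℂ (fun ζ => s.toFun (f ζ)) z := by
  have hcone := hf.mem_cone hX
  obtain ⟨d, F, G, -, -, hG, hs⟩ := s.regular _ hcone.self_of_nhds
  have hcoord : ∀ i, AnalyticAt ℂ (fun ζ => f ζ i) z := fun i =>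
    ((ContinuousLinearMap.proj (R := ℂ) (φ := fun _ : Fin (N + 1) => ℂ) i).analyticAt _).comp hf.1
  have heval : ∀ P : MvPolynomial (Fin (N + 1)) ℂ,
      AnalyticAt ℂ (fun ζ => MvPolynomial.eval (f ζ) P) z := fun P => by
    simpa [MvPolynomial.aeval_eq_eval] using AnalyticAt.aeval_mvPolynomial hcoord P
  refine ((heval F).div (heval G) hG).congr ?_
  filter_upwards [hcone, (heval G).continuousAt.eventually_ne hG] with ζ h1 h2
  exact (hs _ h1 h2).symm

theorem sectionNorm_eq (s : GlobalSection X) (hX : ∀ z, φ z ∈ X) {ζ : ℂ} {v : Coord N}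
    (hv : v ≠ 0) (hφ : φ ζ = Projectivization.mk ℂ v hv) :
    sectionNorm M φ s ζ = ‖s.toFun v‖ * Real.exp (-(1 / 2) * Real.log (M.weight v)) := by
  obtain ⟨a, ha, h⟩ := exists_rep_eq_smul hv hφ
  have hcone : v ∈ cone X := ⟨hv, hφ ▸ hX ζ⟩
  have hw := M.weight_pos v hv
  have ha' := norm_pos_iff.2 ha
  have h1 : Real.exp (-(1 / 2) * Real.log (M.weight v)) = (Real.sqrt (M.weight v))⁻¹ := by
    rw [neg_mul, Real.exp_neg, Real.sqrt_eq_rpow, Real.rpow_def_of_pos hw, mul_comm]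
  rw [sectionNorm, h, s.homogeneous v hcone a ha, M.weight_smul a v ha hv, norm_mul,
    Real.sqrt_mul (by positivity), Real.sqrt_sq ha'.le, h1]
  field_simp

theorem isSectionNorm_sectionNorm (hφ : IsHolomorphic φ) (hX : ∀ z, φ z ∈ X)
    (s : GlobalSection X) :
    IsSectionNorm (sectionNorm M φ s) (multiplicity φ s) (chernDensity M φ) := by
  intro z
  have hl := hφ.isLiftAt_localLift z
  have hc := hl.contDiffAt_log_weight (M := M)
  refine ⟨_, (-(1 / 2) : ℝ) • fun ζ => Real.log (M.weight (localLift φ z ζ)),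
    s.analyticAt_comp_lift hX hl, ⟨hc.const_smul (-(1 / 2) : ℝ), ?_⟩, ?_, rfl⟩
  · filter_upwards [hl.eventually, laplacian_smul_nhds (-(1 / 2) : ℝ) hc] with ζ h1 h2
    rw [h2, h1.chernDensity_eq (M := M) hφ, Pi.smul_apply, smul_eq_mul]
    field_simp
    ring
  · filter_upwards [hl.2] with ζ ⟨h, h'⟩
    exact sectionNorm_eq M s hX h h'

end Weight

end EntireCurve

/-! ### The exceptional set -/

namespace EntireCurve

/-- The choice `κ = 13/20 T` leaves room on both sides: the exceptional disks have total radius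
`3 / κ < 5 / T`, and `e (κ r + 1 / (4 κ r)) ≤ 2 r T` as soon as `r T ≥ 5`. -/
theorem log_add_one_le {K : ℝ} (hK : 5 ≤ K) :
    Real.log (13 / 20 * K + 1 / (4 * (13 / 20 * K))) + 1 ≤ Real.log (2 * K) := by
  have h0 : 0 < 13 / 20 * K + 1 / (4 * (13 / 20 * K)) := by positivity
  rw [show Real.log (13 / 20 * K + 1 / (4 * (13 / 20 * K))) + 1 =
    Real.log ((13 / 20 * K + 1 / (4 * (13 / 20 * K))) * Real.exp 1) by
      rw [Real.log_mul h0.ne' (by positivity), Real.log_exp]]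
  apply Real.log_le_log (by positivity)
  have h1 : 1 / (4 * (13 / 20 * K)) ≤ K / 60 := by
    rw [div_le_div_iff₀ (by positivity) (by norm_num)]
    nlinarith
  calc (13 / 20 * K + 1 / (4 * (13 / 20 * K))) * Real.exp 1
      ≤ (13 / 20 * K + K / 60) * 2.7182818286 := by
        gcongr
        exact Real.exp_one_lt_d9.le
    _ ≤ 2 * K := by linarith

/-- Outside small disks, the Green potentials of `d` on all disks of radius at most `r` are bounded
in terms of the characteristic `T` of `d`. -/
theorem exists_disks_integral_green_le {d : ℂ → ℝ} (hd : Continuous d) (hd0 : ∀ z, 0 ≤ d z)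
    {r T T' : ℝ} (hr : 0 < r)
    (hT : T = ∫ t in (0 : ℝ)..r, (1 / t) * ∫ z in ball (0 : ℂ) t, d z)
    (hT' : T' = ∫ t in (0 : ℝ)..(Real.exp 1 * r), (1 / t) * ∫ z in ball (0 : ℂ) t, d z) :
    ∃ (c : ℕ → ℂ) (ρ : ℕ → ℝ≥0), ∑' i, (ρ i : ℝ≥0∞) < 5 / ENNReal.ofReal T ∧
      ∀ w : ℂ, ‖w‖ < r → w ∉ ⋃ i, ball (c i) (ρ i) → ∀ R, ‖w‖ < R → R ≤ r →
        ∫ z in ball (0 : ℂ) R, green R w z * d z ≤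
          (Real.log T + Real.log r + Real.log 2) * T' := by
  by_cases hrT : r * T < 5
  · -- a single disk covers everything
    refine ⟨0, Pi.single 0 r.toNNReal, ?_, fun w hw hw' => ?_⟩
    · rw [tsum_eq_single 0 fun i hi => by simp [hi]]
      simp only [Pi.single_eq_same]
      change ENNReal.ofReal r < _
      rcases le_or_gt T 0 with h | h
      · rw [ENNReal.ofReal_of_nonpos h, ENNReal.div_zero (by norm_num)]
        exact ENNReal.ofReal_lt_top
      · rw [ENNReal.lt_div_iff_mul_lt (.inr ENNReal.ofReal_ne_top) (.inl ENNReal.ofReal_ne_top),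
          ← ENNReal.ofReal_mul hr.le]
        calc ENNReal.ofReal (r * T) < ENNReal.ofReal 5 :=
              (ENNReal.ofReal_lt_ofReal_iff (by norm_num)).2 hrT
          _ = 5 := by norm_num
    · refine absurd (mem_iUnion.2 ⟨0, ?_⟩) hw'
      simpa [hr.le] using hw
  · rw [not_lt] at hrT
    have hT0 : 0 < T := by
      by_contra h
      nlinarith
    set n := ∫ z in ball (0 : ℂ) r, d z with hn
    have hn0 : 0 < n := by
      by_contra h
      exact absurd (characteristic_nonpos hd hd0 hr (not_lt.1 h)) (not_le.2 (hT ▸ hT0))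
    have hnT' : n ≤ T' := hT' ▸ integral_ball_le_characteristic hd hd0 hr
    set κ := 13 / 20 * T with hκ
    have hκ0 : 0 < κ := by positivity
    set μ := (volume.restrict (ball (0 : ℂ) r)).withDensity fun z => ENNReal.ofReal (d z) with hμ
    have hμn : μ univ ≤ ENNReal.ofReal n := by
      rw [hμ, withDensity_apply _ MeasurableSet.univ, Measure.restrict_univ, hn,
        ofReal_integral_eq_lintegral_ofReal (integrableOn_ball hd r) (.of_forall hd0)]
    obtain ⟨c, ρ, hρ, hconc⟩ := exists_disks_measure_closedBall_le μ
      (l := n * κ) (by positivity) hμn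
    refine ⟨c, ρ, hρ.trans_lt ?_, fun w hw hw' R hwR hRr => ?_⟩
    · rw [ENNReal.lt_div_iff_mul_lt (.inr ENNReal.ofReal_ne_top) (.inl ENNReal.ofReal_ne_top),
        ← ENNReal.ofReal_mul (by positivity)]
      have : 3 * (n / (n * κ)) * T = 60 / 13 := by
        rw [hκ]
        field_simp
        norm_num
      rw [this]
      calc ENNReal.ofReal (60 / 13) < ENNReal.ofReal 5 :=
            (ENNReal.ofReal_lt_ofReal_iff (by norm_num)).2 (by norm_num)
        _ = 5 := by norm_num
    · have h1 := integral_green_mul_le hd hd0 hwR hRr hκ0 (by rw [hκ]; nlinarith) hn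
        (hconc w hw')
      have h2 : r * κ = 13 / 20 * (r * T) := by rw [hκ]; ring
      have h3 := log_add_one_le hrT
      have h4 : Real.log T + Real.log r + Real.log 2 = Real.log (2 * (r * T)) := by
        rw [Real.log_mul (by norm_num) (by positivity), Real.log_mul hr.ne' hT0.ne']
        ring
      have h5 : 0 ≤ Real.log (2 * (r * T)) := Real.log_nonneg (by linarith)
      rw [h2] at h1
      rw [h4]
      calc _ ≤ n * (Real.log (13 / 20 * (r * T) + 1 / (4 * (13 / 20 * (r * T)))) + 1) := h1
        _ ≤ n * Real.log (2 * (r * T)) := by gcongr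
        _ ≤ Real.log (2 * (r * T)) * T' := by
          rw [mul_comm]
          gcongr

end EntireCurve

theorem theorem3p5 {N : ℕ} (X : Set (EntireCurve.PSpace N))
    (hX : EntireCurve.IsProjectiveVariety X) (M : EntireCurve.PositiveMetric X)
    (φ : ℂ → EntireCurve.PSpace N) (hφ : EntireCurve.IsHolomorphic φ) (hφX : ∀ z, φ z ∈ X)
    (r : ℝ) (hr : 0 < r) :
    ∃ (c : ℕ → ℂ) (ρ : ℕ → ℝ≥0),
      ∑' i, (ρ i : ℝ≥0∞) < 5 / ENNReal.ofReal (EntireCurve.characteristic M φ r) ∧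
      ∀ (s : EntireCurve.GlobalSection X) (w₀ : ℂ), ‖w₀‖ < r →
        w₀ ∉ ⋃ i, ball (c i) (ρ i) →
        EntireCurve.sectionNorm M φ s w₀ ≠ 0 →
        {z ∈ ball (0 : ℂ) r | EntireCurve.multiplicity φ s z ≠ 0}.Finite ∧
        ∑ᶠ z ∈ ball (0 : ℂ) r, (EntireCurve.multiplicity φ s z : ℝ) * EntireCurve.green r w₀ z +
            Real.log (EntireCurve.sectionNorm M φ s w₀) ≤
          Real.log (EntireCurve.supNorm M φ s r) +
            (Real.log (EntireCurve.characteristic M φ r) + Real.log r + Real.log 2) *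
              EntireCurve.characteristic M φ (Real.exp 1 * r) := by
  obtain ⟨c, ρ, hρ, hbound⟩ := EntireCurve.exists_disks_integral_green_le
    (EntireCurve.continuous_chernDensity M hφ) (EntireCurve.chernDensity_nonneg M hφ hφX) hr
    (rfl : EntireCurve.characteristic M φ r = _)
    (rfl : EntireCurve.characteristic M φ (Real.exp 1 * r) = _)
  refine ⟨c, ρ, hρ, fun s w₀ hw₀ hmem hs => ?_⟩
  have hnorm := EntireCurve.isSectionNorm_sectionNorm M hφ hφX s
  exact ⟨hnorm.finite_zeros hs r, hnorm.finsum_green_add_log_le hw₀ hs (hbound w₀ hw₀ hmem)⟩
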